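/- Let $n\ge 2$ and let $O_n$ be the Cuntz algebra, the universal $C^*$-algebra generated by isometries $S_1,\dots,S_n$ with $\sum_i S_iS_i^*=1$. Let $\gamma$ be the gauge action of the circle, $\gamma_z(S_i)=zS_i$, let $F=O_n^{\gamma}$ be its fixed point algebra, and let $\Phi:O_n\to F$, $\Phi(a)=\frac1{2\pi}\int_0^{2\pi}\gamma_{e^{i\theta}}(a)\,d\theta$, be the canonical expectation. Let $X_c=\operatorname{span}\{S_\mu S_\nu^*:\mu,\nu \text{ finite words in }\{1,\dots,n\}\}\subset O_n$ with the $F$-valued inner product $(x|y)_R=\Phi(x^*y)$. Then $F$ has exactly one faithful normalised trace (faithful tracial state) $\tau$. Let $\mathcal H=L^2(O_n)$ be the completion of $O_n$ for the inner product $\langle a,b\rangle=(\tau\circ\Phi)(a^*b)$. For $x,y\in X_c$ let $\Theta_{x,y}$ be the rank one endomorphism $\Theta_{x,y}z=x\,(y|z)_R=x\,\Phi(y^*z)$, extended to a bounded operator on $\mathcal H$; let $\mathrm{End}^{00}_F(X_c)$ be the linear span of all $\Theta_{x,y}$, and let $$\mathcal N=(\mathrm{End}^{00}_F(X_c))''$$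 where the commutants are taken in $\mathcal B(\mathcal H)$. Let $\mathcal D$, the generator of the gauge action, be the closure in $\mathcal H$ of the operator with domain $X_c$ given by $\mathcal D(S_\mu S_\nu^*)=(|\mu|-|\nu|)S_\mu S_\nu^*$. Then: 1. $\mathcal N$ is semifinite. 2. There is a faithful normal semifinite trace $\tilde\tau:\mathcal N_+\to[0,\infty]$ such that for all $x,y\in X_c$ the operator $\Theta_{x,y}$ lies in the domain of definition $\operatorname{span}\{T\in\mathcal N_+:\tilde\tau(T)<\infty\}$ of $\tilde\tau$ and, for the linear extension of $\tilde\tau$ to this domain, $$\tilde\tau(\Theta_{x,y})=(\tau\circ\Phi)(y^*x).$$ 3. $\mathcal D$ is affiliated to $\mathcal N$, that is, $\mathcal D$ is closed and densely defined and $u\mathcal D u^*=\mathcal D$ for every unitary $u\in\mathcal N'$. -/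

import Mathlib

open scoped ENNReal NNReal ComplexOrder InnerProductSpace
open MeasureTheory

/-! ## Von Neumann algebras -/

namespace VonNeumannAlgebra

variable {H : Type*} [NormedAddCommGroup H] [InnerProductSpace ℂ H] [CompleteSpace H]

/-- The double commutant of a star-closed set of operators. -/
noncomputable def bicommutant (s : Set (H →L[ℂ] H)) (hs : ∀ T ∈ s, star T ∈ s) :
    VonNeumannAlgebra H where
  carrier := s.centralizer.centralizer
  mul_mem' := Set.mul_mem_centralizer
  one_mem' := Set.one_mem_centralizer
  add_mem' := Set.add_mem_centralizer
  zero_mem' := Set.zero_mem_centralizer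
  algebraMap_mem' c T _ := (Algebra.commutes c T).symm
  star_mem' := Set.star_mem_centralizer' fun _ => Set.star_mem_centralizer' hs
  centralizer_centralizer' := by simp

/-- A projection of `N` is finite if it is not Murray-von Neumann equivalent, in `N`, to a proper
subprojection of itself. -/
structure IsFiniteProjection (N : VonNeumannAlgebra H) (p : H →L[ℂ] H) : Prop where
  mem : p ∈ N
  isStarProjection : IsStarProjection p
  finite : ∀ v ∈ N, star v * v = p → v * star v ≤ p → v * star v = p

/-- `N` is semifinite if every nonzero central projection majorizes a nonzero finite one. -/
def IsSemifinite (N : VonNeumannAlgebra H) : Prop :=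
  ∀ z ∈ N, z ∈ N.commutant → IsStarProjection z → z ≠ 0 →
    ∃ p, N.IsFiniteProjection p ∧ p ≠ 0 ∧ p ≤ z

/-- A faithful normal semifinite trace `N₊ → [0, ∞]`. Only the values of `τ` on the positive cone
of `N` are relevant. -/
structure IsFNSTrace (N : VonNeumannAlgebra H) (τ : (H →L[ℂ] H) → ℝ≥0∞) : Prop where
  map_add : ∀ S ∈ N, ∀ T ∈ N, 0 ≤ S → 0 ≤ T → τ (S + T) = τ S + τ T
  map_smul : ∀ c : ℝ≥0, ∀ T ∈ N, 0 ≤ T → τ ((c : ℂ) • T) = c * τ T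
  tracial : ∀ T ∈ N, τ (star T * T) = τ (T * star T)
  faithful : ∀ T ∈ N, 0 ≤ T → τ T = 0 → T = 0
  /-- `τ` preserves suprema of bounded increasing nets of positive elements. -/
  normal : ∀ (s : Set (H →L[ℂ] H)) (T : H →L[ℂ] H), s.Nonempty → DirectedOn (· ≤ ·) s →
    (∀ S ∈ s, S ∈ N ∧ 0 ≤ S) → IsLUB s T → τ T = ⨆ S ∈ s, τ S
  semifinite : ∀ T ∈ N, 0 ≤ T → T ≠ 0 → ∃ S ∈ N, 0 ≤ S ∧ S ≤ T ∧ S ≠ 0 ∧ τ S < ∞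

/-- The domain of definition of a trace: the span of the positive elements of finite trace. -/
def traceDomain (N : VonNeumannAlgebra H) (τ : (H →L[ℂ] H) → ℝ≥0∞) : Submodule ℂ (H →L[ℂ] H) :=
  Submodule.span ℂ {T | T ∈ N ∧ 0 ≤ T ∧ τ T < ∞}

/-- A closed densely defined operator `D` is affiliated to `N` if `u D = D u` for every unitary `u`
in the commutant of `N`. (As this is required also of `u⁻¹`, the inclusion `u D ⊆ D u` suffices.) -/
structure IsAffiliated (N : VonNeumannAlgebra H) (D : H →ₗ.[ℂ] H) : Prop where
  isClosed : D.IsClosed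
  dense_domain : Dense (D.domain : Set H)
  commute : ∀ u ∈ N.commutant, u ∈ unitary (H →L[ℂ] H) → ∀ ξ : D.domain,
    ∃ h : u (ξ : H) ∈ D.domain, D ⟨u (ξ : H), h⟩ = u (D ξ)

end VonNeumannAlgebra


/-! ## The Cuntz algebra -/

/-- The Hilbert space `ℓ²(ℕ)`. -/
abbrev SeqHilbert : Type := lp (fun _ : ℕ => ℂ) 2

instance : Nontrivial SeqHilbert :=
  ⟨lp.single 2 (0 : ℕ) (1 : ℂ), 0, fun h => by
    have := congrArg (fun x : SeqHilbert => x 0) h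
    simp at this⟩

/-- A Cuntz family on `ℓ²(ℕ)`: isometries `S₁, …, Sₙ` with `∑ Sᵢ Sᵢ* = 1`. -/
def CuntzFamily (n : ℕ) : Type :=
  {S : Fin n → (SeqHilbert →L[ℂ] SeqHilbert) //
    (∀ i, star (S i) * S i = 1) ∧ ∑ i, S i * star (S i) = 1}

/-- The `ℓ^∞`-product of copies of `B(ℓ²(ℕ))`, one for each Cuntz family. -/
abbrev CuntzAmbient (n : ℕ) : Type :=
  lp (fun _ : CuntzFamily n => SeqHilbert →L[ℂ] SeqHilbert) ∞

noncomputable instance (n : ℕ) : CStarAlgebra (CuntzAmbient n) where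

lemma CuntzFamily.norm_le_one {n : ℕ} (r : CuntzFamily n) (i : Fin n) : ‖r.1 i‖ ≤ 1 := by
  have h := CStarRing.norm_star_mul_self (x := r.1 i)
  rw [r.2.1 i, norm_one] at h
  nlinarith [norm_nonneg (r.1 i)]

/-- The universal generator: in the coordinate of the Cuntz family `r` it is `r i`. -/
def cuntzAmbientGen (n : ℕ) (i : Fin n) : CuntzAmbient n :=
  ⟨fun r => r.1 i, memℓp_infty ⟨1, by rintro _ ⟨r, rfl⟩; exact r.norm_le_one i⟩⟩

/-- The closed unital star subalgebra generated by the universal generators. -/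
noncomputable def cuntzSubalgebra (n : ℕ) : StarSubalgebra ℂ (CuntzAmbient n) :=
  (StarAlgebra.adjoin ℂ (Set.range (cuntzAmbientGen n))).topologicalClosure

/-- The Cuntz algebra `O_n`, that is, the universal C⋆-algebra generated by isometries
`S₁, …, Sₙ` with `∑ Sᵢ Sᵢ* = 1`. The norm of a star polynomial in the generators is its supremum
over all Cuntz families on `ℓ²(ℕ)`; these suffice because a representation of the relations is a
direct sum of cyclic ones, and cyclic ones live on separable Hilbert spaces. -/
def CuntzAlgebra (n : ℕ) : Type := cuntzSubalgebra n

namespace CuntzAlgebra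

instance isClosed_cuntzSubalgebra (n : ℕ) : IsClosed (cuntzSubalgebra n : Set (CuntzAmbient n)) :=
  StarSubalgebra.isClosed_topologicalClosure _

noncomputable instance (n : ℕ) : CStarAlgebra (CuntzAlgebra n) :=
  inferInstanceAs (CStarAlgebra (cuntzSubalgebra n))

/-- The usual order of a C⋆-algebra: `a ≤ b` if and only if `b - a` is positive. -/
noncomputable instance (n : ℕ) : PartialOrder (CuntzAlgebra n) := CStarAlgebra.spectralOrder _

instance (n : ℕ) : StarOrderedRing (CuntzAlgebra n) := CStarAlgebra.spectralOrderedRing _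

/-- The inclusion of the Cuntz algebra in the `ℓ^∞`-product. -/
noncomputable def incl (n : ℕ) : CuntzAlgebra n →⋆ₐ[ℂ] CuntzAmbient n := (cuntzSubalgebra n).subtype

/-- The generating isometries `S₁, …, Sₙ` of `O_n`. -/
noncomputable def gen {n : ℕ} (i : Fin n) : CuntzAlgebra n :=
  ⟨cuntzAmbientGen n i, (StarSubalgebra.le_topologicalClosure _)
    (StarAlgebra.subset_adjoin ℂ _ ⟨i, rfl⟩)⟩

lemma star_gen_mul_gen {n : ℕ} (i : Fin n) : star (gen i) * gen i = (1 : CuntzAlgebra n) := by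
  apply Subtype.ext
  apply Subtype.ext
  funext r
  exact r.2.1 i

lemma sum_gen_mul_star {n : ℕ} : ∑ i, gen i * star (gen i) = (1 : CuntzAlgebra n) := by
  have h : Function.Injective (incl n) := Subtype.val_injective
  apply h
  apply Subtype.ext
  funext r
  rw [map_sum, map_one]
  have : ((∑ i, incl n (gen i * star (gen i)) : CuntzAmbient n) : ∀ _ : CuntzFamily n, _) r
      = ∑ i, r.1 i * star (r.1 i) := by
    rw [lp.coeFn_sum, Finset.sum_apply]
    rfl
  rw [this, r.2.2]
  rfl

/-! ### The gauge action -/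

/-- The Cuntz family `z S₁, …, z Sₙ`. -/
noncomputable def twist {n : ℕ} (z : Circle) (r : CuntzFamily n) : CuntzFamily n :=
  ⟨fun i => (z : ℂ) • r.1 i, by
    have hz : (starRingEnd ℂ) (z : ℂ) * (z : ℂ) = 1 := by
      rw [mul_comm, Complex.mul_conj, Circle.normSq_coe, Complex.ofReal_one]
    constructor
    · intro i
      rw [star_smul, smul_mul_smul_comm, r.2.1 i]
      simp [hz]
    · refine Eq.trans (Finset.sum_congr rfl fun i _ => ?_) r.2.2
      rw [star_smul, smul_mul_smul_comm, mul_comm]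
      simp [hz]⟩

/-- The gauge action on the product: relabel the coordinates along `r ↦ z r`. -/
noncomputable def ambientGauge (n : ℕ) (z : Circle) : CuntzAmbient n →⋆ₐ[ℂ] CuntzAmbient n where
  toFun a := ⟨fun r => a (twist z r), memℓp_infty ⟨‖a‖, by
    rintro _ ⟨r, rfl⟩; exact lp.norm_apply_le_norm (by simp) a _⟩⟩
  map_one' := rfl
  map_mul' _ _ := rfl
  map_zero' := rfl
  map_add' _ _ := rfl
  commutes' _ := rfl
  map_star' _ := rfl

lemma ambientGauge_gen (n : ℕ) (z : Circle) (i : Fin n) :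
    ambientGauge n z (cuntzAmbientGen n i) = (z : ℂ) • cuntzAmbientGen n i := rfl

lemma ambientGauge_mem {n : ℕ} (z : Circle) {a : CuntzAmbient n} (ha : a ∈ cuntzSubalgebra n) :
    ambientGauge n z a ∈ cuntzSubalgebra n := by
  have hc : Continuous (ambientGauge n z) := by
    have := AddMonoidHomClass.continuous_of_bound (ambientGauge n z) 1 (fun a => by simpa using NonUnitalStarAlgHom.norm_apply_le (ambientGauge n z) a)
    exact this
  have h1 : StarAlgebra.adjoin ℂ (Set.range (cuntzAmbientGen n)) ≤
      (cuntzSubalgebra n).comap (ambientGauge n z) := by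
    rw [StarAlgebra.adjoin_le_iff]
    rintro _ ⟨i, rfl⟩
    change ambientGauge n z _ ∈ cuntzSubalgebra n
    rw [ambientGauge_gen]
    exact (cuntzSubalgebra n).smul_mem (gen i).2 _
  have h2 : IsClosed (((cuntzSubalgebra n).comap (ambientGauge n z)) : Set (CuntzAmbient n)) :=
    (isClosed_cuntzSubalgebra n).preimage hc
  exact StarSubalgebra.topologicalClosure_minimal h1 h2 ha

/-- The gauge automorphism `γ_z` of `O_n`, determined by `γ_z(Sᵢ) = z Sᵢ`. -/
noncomputable def gauge {n : ℕ} (z : Circle) : CuntzAlgebra n →⋆ₐ[ℂ] CuntzAlgebra n :=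
  StarAlgHom.codRestrict ((ambientGauge n z).comp (incl n)) (cuntzSubalgebra n)
    fun a => ambientGauge_mem z a.2

lemma gauge_gen {n : ℕ} (z : Circle) (i : Fin n) :
    gauge z (gen i) = (z : ℂ) • (gen i : CuntzAlgebra n) := rfl

lemma gauge_mul {n : ℕ} (z w : Circle) (a : CuntzAlgebra n) :
    gauge (z * w) a = gauge z (gauge w a) := by
  apply Subtype.ext
  apply Subtype.ext
  funext r
  change (a.1 : ∀ _ : CuntzFamily n, _) (twist (z * w) r) = a.1 (twist w (twist z r))
  have h : twist (z * w) r = twist w (twist z r) := by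
    apply Subtype.ext
    funext i
    change ((z * w : Circle) : ℂ) • r.1 i = (w : ℂ) • (z : ℂ) • r.1 i
    rw [smul_smul, mul_comm (w : ℂ), Circle.coe_mul]
  rw [h]

/-- `γ_z` as a continuous linear map. -/
noncomputable def gaugeL {n : ℕ} (z : Circle) : CuntzAlgebra n →L[ℂ] CuntzAlgebra n :=
  (gauge z : CuntzAlgebra n →⋆ₐ[ℂ] CuntzAlgebra n).toAlgHom.toLinearMap.mkContinuous 1 fun a => by
    rw [one_mul]; exact NonUnitalStarAlgHom.norm_apply_le (gauge z) a

lemma gaugeL_apply {n : ℕ} (z : Circle) (a : CuntzAlgebra n) : gaugeL z a = gauge z a := rfl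

lemma continuous_ambientGauge {n : ℕ} {b : CuntzAmbient n}
    (hb : b ∈ StarAlgebra.adjoin ℂ (Set.range (cuntzAmbientGen n))) :
    Continuous fun z : Circle => ambientGauge n z b := by
  induction hb using StarAlgebra.adjoin_induction with
  | mem x hx =>
    obtain ⟨i, rfl⟩ := hx
    simp only [ambientGauge_gen]
    exact (continuous_subtype_val : Continuous fun z : Circle => (z : ℂ)).smul continuous_const
  | algebraMap r => simp only [AlgHomClass.commutes]; exact continuous_const
  | add x y _ _ hx hy => simp only [map_add]; exact hx.add hy
  | mul x y _ _ hx hy => simp only [map_mul]; exact hx.mul hy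
  | star x _ hx => simp only [map_star]; exact hx.star

/-- The gauge action is strongly continuous. -/
lemma continuous_gauge {n : ℕ} (a : CuntzAlgebra n) : Continuous fun z : Circle => gauge z a := by
  have key : Continuous fun z : Circle => ambientGauge n z a.1 := by
    refine continuous_of_uniform_approx_of_continuous fun u hu => ?_
    obtain ⟨ε, hε, hu⟩ := Metric.mem_uniformity_dist.1 hu
    obtain ⟨b, hb, hab⟩ := Metric.mem_closure_iff.1 (show a.1 ∈ closure
      (StarAlgebra.adjoin ℂ (Set.range (cuntzAmbientGen n)) : Set (CuntzAmbient n)) from a.2) ε hε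
    refine ⟨fun z => ambientGauge n z b, continuous_ambientGauge hb, fun z => hu ?_⟩
    rw [dist_eq_norm] at hab ⊢
    rw [← map_sub]
    exact (NonUnitalStarAlgHom.norm_apply_le (ambientGauge n z) _).trans_lt hab
  exact Continuous.subtype_mk key _

/-! ### The conditional expectation -/

/-- The fixed point algebra `F` of the gauge action. -/
noncomputable def core (n : ℕ) : StarSubalgebra ℂ (CuntzAlgebra n) where
  carrier := {a | ∀ z : Circle, gauge z a = a}
  mul_mem' ha hb z := by rw [map_mul, ha z, hb z]
  add_mem' ha hb z := by rw [map_add, ha z, hb z]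
  algebraMap_mem' c z := AlgHomClass.commutes (gauge z) c
  star_mem' ha z := by rw [map_star, ha z]

/-- `Φ(a) = (2π)⁻¹ ∫₀^{2π} γ_{exp(iθ)}(a) dθ`. -/
noncomputable def gaugeMean {n : ℕ} (a : CuntzAlgebra n) : CuntzAlgebra n :=
  (2 * Real.pi)⁻¹ • ∫ θ in (0 : ℝ)..(2 * Real.pi), gauge (Circle.exp θ) a

lemma continuous_gauge_exp {n : ℕ} (a : CuntzAlgebra n) :
    Continuous fun θ : ℝ => gauge (Circle.exp θ) a :=
  (continuous_gauge a).comp Circle.exp.continuous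

lemma gaugeMean_mem {n : ℕ} (a : CuntzAlgebra n) : gaugeMean a ∈ core n := by
  intro z
  obtain ⟨t, rfl⟩ : ∃ t : ℝ, Circle.exp t = z := ⟨Complex.arg z, Circle.exp_arg z⟩
  have hint : IntervalIntegrable (fun θ : ℝ => gauge (Circle.exp θ) a) volume 0 (2 * Real.pi) :=
    (continuous_gauge_exp a).intervalIntegrable _ _
  have hper : Function.Periodic (fun θ : ℝ => gauge (Circle.exp θ) a) (2 * Real.pi) := fun θ => by
    change gauge (Circle.exp (θ + 2 * Real.pi)) a = _
    rw [Circle.periodic_exp θ]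
  rw [← gaugeL_apply, gaugeMean, ← Complex.coe_smul, map_smul,
    ← ContinuousLinearMap.intervalIntegral_comp_comm _ hint]
  congr 1
  simp only [gaugeL_apply, ← gauge_mul, ← Circle.exp_add]
  simp only [add_comm t]
  rw [intervalIntegral.integral_comp_add_right (fun θ : ℝ => gauge (Circle.exp θ) a) t]
  rw [add_comm (2 * Real.pi) t]
  have := hper.intervalIntegral_add_eq (0 + t) 0
  simpa only [zero_add] using this

lemma gaugeMean_nonneg {n : ℕ} {a : CuntzAlgebra n} (ha : 0 ≤ a) : 0 ≤ gaugeMean a := by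
  have h : ∀ θ : ℝ, 0 ≤ gauge (Circle.exp θ) a := fun θ => map_nonneg (gauge (Circle.exp θ)) ha
  rw [gaugeMean, intervalIntegral.integral_of_le Real.two_pi_pos.le]
  exact smul_nonneg (inv_nonneg.2 Real.two_pi_pos.le) (integral_nonneg h)

lemma gaugeMean_add {n : ℕ} (a b : CuntzAlgebra n) :
    gaugeMean (a + b) = gaugeMean a + gaugeMean b := by
  simp only [gaugeMean, map_add]
  rw [intervalIntegral.integral_add ((continuous_gauge_exp a).intervalIntegrable _ _)
    ((continuous_gauge_exp b).intervalIntegrable _ _), smul_add]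

lemma gaugeMean_smul {n : ℕ} (c : ℂ) (a : CuntzAlgebra n) :
    gaugeMean (c • a) = c • gaugeMean a := by
  simp only [gaugeMean, map_smul]
  rw [intervalIntegral.integral_smul, smul_comm]

lemma gaugeMean_mul {n : ℕ} {f : CuntzAlgebra n} (hf : f ∈ core n) (a : CuntzAlgebra n) :
    gaugeMean (f * a) = f * gaugeMean a := by
  have h : ∀ θ : ℝ, gauge (Circle.exp θ) (f * a) =
      ContinuousLinearMap.mul ℂ _ f (gauge (Circle.exp θ) a) := fun θ => by
    rw [map_mul, hf, ContinuousLinearMap.mul_apply']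
  simp only [gaugeMean, h]
  rw [ContinuousLinearMap.intervalIntegral_comp_comm _
    ((continuous_gauge_exp a).intervalIntegrable _ _), ContinuousLinearMap.mul_apply',
    mul_smul_comm]

/-- The expectation `Φ : O_n → F`, as a positive linear map. -/
noncomputable def expectation (n : ℕ) : CuntzAlgebra n →ₚ[ℂ] core n :=
  PositiveLinearMap.mk₀
    { toFun := fun a => ⟨gaugeMean a, gaugeMean_mem a⟩
      map_add' := fun a b => Subtype.ext (gaugeMean_add a b)
      map_smul' := fun c a => Subtype.ext (gaugeMean_smul c a) }
    fun _ ha => gaugeMean_nonneg ha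

/-- `τ` is a faithful normalised trace on the fixed point algebra `F`. -/
structure IsFaithfulNormalizedTrace {n : ℕ} (τ : core n →ₚ[ℂ] ℂ) : Prop where
  map_one : τ 1 = 1
  map_mul_comm : ∀ a b, τ (a * b) = τ (b * a)
  faithful : ∀ a, τ (star a * a) = 0 → a = 0

/-- The state `τ ∘ Φ` on `O_n`. -/
noncomputable def gaugeState {n : ℕ} (τ : core n →ₚ[ℂ] ℂ) : CuntzAlgebra n →ₚ[ℂ] ℂ :=
  τ.comp (expectation n)

/-- The element `S_μ S_ν*` for two words `μ`, `ν` in `{1, …, n}`. -/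
noncomputable def monomial {n : ℕ} (μ ν : List (Fin n)) : CuntzAlgebra n :=
  (μ.map gen).prod * star (ν.map gen).prod

/-- `O_{nc}`, the linear span of the elements `S_μ S_ν*`. As a right module over `F` (or `F_c`), with
the inner product `(a|b)_R = Φ(a* b)`, it is `X_c`. -/
noncomputable def algSpan (n : ℕ) : Submodule ℂ (CuntzAlgebra n) :=
  Submodule.span ℂ {a | ∃ μ ν : List (Fin n), a = monomial μ ν}

section Hilbert

variable {n : ℕ} (τ : core n →ₚ[ℂ] ℂ)

/-- The Hilbert space `L²(O_n)`: the completion of `O_n` for `⟨a, b⟩ = (τ ∘ Φ)(a* b)`. -/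
abbrev L2 : Type := (gaugeState τ).GNS

/-- The canonical linear map of `O_n` into `L²(O_n)`. -/
noncomputable def toL2 : CuntzAlgebra n →ₗ[ℂ] L2 τ :=
  (UniformSpace.Completion.toComplL (𝕜 := ℂ) (E := (gaugeState τ).PreGNS)).toLinearMap ∘ₗ
    (gaugeState τ).toPreGNS.toLinearMap

lemma inner_toL2 (a b : CuntzAlgebra n) :
    ⟪toL2 τ a, toL2 τ b⟫_ℂ = gaugeState τ (star a * b) :=
  UniformSpace.Completion.inner_coe _ _

/-- Left multiplication of `O_n` on `L²(O_n)`. -/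
noncomputable def leftMul : CuntzAlgebra n →⋆ₐ[ℂ] (L2 τ →L[ℂ] L2 τ) := (gaugeState τ).gnsStarAlgHom

lemma leftMul_toL2 (a b : CuntzAlgebra n) : leftMul τ a (toL2 τ b) = toL2 τ (a * b) :=
  PositiveLinearMap.gnsNonUnitalStarAlgHom_apply_coe (gaugeState τ)

/-- The closure of `F` in `L²(O_n)`. -/
noncomputable def coreL2 : Submodule ℂ (L2 τ) :=
  ((core n).toSubalgebra.toSubmodule.map (toL2 τ)).topologicalClosure

instance : CompleteSpace (coreL2 τ) :=
  (Submodule.isClosed_topologicalClosure _).completeSpace_coe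

lemma starProjection_toL2 (a : CuntzAlgebra n) :
    (coreL2 τ).starProjection (toL2 τ a) = toL2 τ (expectation n a : CuntzAlgebra n) := by
  refine Submodule.eq_starProjection_of_mem_orthogonal
    (Submodule.le_topologicalClosure _ ⟨_, (expectation n a).2, rfl⟩) ?_
  rw [coreL2, Submodule.orthogonal_closure, Submodule.mem_orthogonal]
  rintro _ ⟨f, hf, rfl⟩
  have hf' : star f ∈ core n := (core n).star_mem' hf
  have hidem : gaugeMean (gaugeMean a) = gaugeMean a := by
    have h := gaugeMean_mul (gaugeMean_mem a) 1
    have h1 : gaugeMean (1 : CuntzAlgebra n) = 1 := by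
      simp only [gaugeMean, map_one, intervalIntegral.integral_const, sub_zero]
      rw [smul_smul, inv_mul_cancel₀ Real.two_pi_pos.ne', one_smul]
    rwa [h1, mul_one] at h
  rw [← map_sub, inner_toL2]
  have h0 : expectation n (star f * (a - (expectation n a : CuntzAlgebra n))) = 0 := by
    apply Subtype.ext
    change gaugeMean (star f * (a - gaugeMean a)) = 0
    rw [gaugeMean_mul hf', sub_eq_add_neg, ← neg_one_smul ℂ (gaugeMean a), gaugeMean_add,
      gaugeMean_smul, hidem]
    simp
  change τ (expectation n _) = 0
  rw [h0, map_zero]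

/-- The rank one endomorphism `Θ_{x,y} z = x (y|z)_R = x Φ(y* z)`, as a bounded operator on
`L²(O_n)`: the map `z ↦ Φ(z)` extends to the projection on the closure of `F`. -/
noncomputable def rankOneEnd (x y : CuntzAlgebra n) : L2 τ →L[ℂ] L2 τ :=
  leftMul τ x ∘L (coreL2 τ).starProjection ∘L leftMul τ (star y)

/-- The defining formula of `Θ_{x,y}` on the dense subspace `O_n` of `L²(O_n)`. -/
lemma rankOneEnd_toL2 (x y z : CuntzAlgebra n) :
    rankOneEnd τ x y (toL2 τ z) = toL2 τ (x * (expectation n (star y * z) : CuntzAlgebra n)) := by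
  change leftMul τ x ((coreL2 τ).starProjection (leftMul τ (star y) (toL2 τ z))) = _
  rw [leftMul_toL2, starProjection_toL2, leftMul_toL2]

lemma star_rankOneEnd (x y : CuntzAlgebra n) :
    star (rankOneEnd τ x y) = rankOneEnd τ y x := by
  change star (leftMul τ x * ((coreL2 τ).starProjection * leftMul τ (star y))) =
    leftMul τ y * ((coreL2 τ).starProjection * leftMul τ (star x))
  rw [star_mul, star_mul, (isSelfAdjoint_starProjection (coreL2 τ)).star_eq, ← map_star,
    ← map_star, star_star, mul_assoc]

/-- `End⁰⁰_F(X_c)`: the finite rank endomorphisms of `X_c`, acting on `L²(O_n)`. -/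
noncomputable def finiteRankEnd : Submodule ℂ (L2 τ →L[ℂ] L2 τ) :=
  Submodule.span ℂ {T | ∃ x ∈ algSpan n, ∃ y ∈ algSpan n, T = rankOneEnd τ x y}

lemma star_mem_finiteRankEnd {T : L2 τ →L[ℂ] L2 τ} (hT : T ∈ finiteRankEnd τ) :
    star T ∈ finiteRankEnd τ := by
  induction hT using Submodule.span_induction with
  | mem x hx =>
    obtain ⟨x, hx, y, hy, rfl⟩ := hx
    exact Submodule.subset_span ⟨y, hy, x, hx, star_rankOneEnd τ x y⟩
  | zero => simp
  | add S T _ _ hS hT => rw [star_add]; exact add_mem hS hT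
  | smul c T _ hT => rw [star_smul]; exact Submodule.smul_mem _ _ hT

/-- The von Neumann algebra `N = (End⁰⁰_F(X_c))''`. -/
noncomputable def endVN : VonNeumannAlgebra (L2 τ) :=
  VonNeumannAlgebra.bicommutant (finiteRankEnd τ) fun _ => star_mem_finiteRankEnd τ

/-- The generator of the gauge action: the closure of the operator with domain `X_c` and
`D(S_μ S_ν*) = (|μ| - |ν|) S_μ S_ν*`. -/
noncomputable def gaugeGenerator : L2 τ →ₗ.[ℂ] L2 τ :=
  (Submodule.span ℂ {p : L2 τ × L2 τ | ∃ μ ν : List (Fin n),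
    p = (toL2 τ (monomial μ ν),
      ((μ.length : ℂ) - (ν.length : ℂ)) • toL2 τ (monomial μ ν))}).topologicalClosure.toLinearPMap

end Hilbert

end CuntzAlgebra

open CuntzAlgebra

section

open Filter Topology

/-! ### Limits along ultrafilters and suprema of increasing nets of operators -/

/-! The trace on `F`. The monomials `S_μ S_ν*` with `|μ| = |ν| = k` span a matrix algebra `matrixAlg
n k`; these algebras increase with `k` and their union is dense in `F`. The map `a ↦ n⁻¹ ∑ Sᵢ* a Sᵢ`
lowers `k` by one, so `k` iterations turn a matrix into a scalar, its normalised trace. Composing a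
state with the `m`-th iterate and passing to an ultrafilter limit in `m` gives a tracial state
(`exists_tracial_state`). It is faithful on each matrix algebra, so the representation of `F` on the
closure of `F` in `L²` is isometric on each of them, hence on `F`; as the vector `1` separates `F`
there by traciality, the state is faithful (`faithful_of_matrixAlg`). Uniqueness holds because
traciality and normalisation determine the values on matrix units.

The algebra `N`. The module `X_c` has an orthogonal frame `ξ`: all the `S_μ`, together with the
powers `(S_{i₀}*)^k` for `k ≥ 1`. The operators `Θ_{ξ,ξ}` are mutually orthogonal projections in
`N`, and they sum strongly to `1` since each monomial is fixed by one of them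
(`exists_frame_reproduces`, `hasSum_frameProj`). The trace is `T ↦ ∑ ⟨T ξ, ξ⟩`. Additivity and
normality are inherited from vector states. The other properties use that `N` commutes with right
multiplication by `F`, which is bounded on `L²` because `τ` is tracial (`norm_toL2_mul_le`). Thus `T
ξ = 0` for all `ξ` forces `T (ξ f) = 0` for `f` in `F`, whence faithfulness. The entries `A` of `T`
in the frame act on the closure of `F` and satisfy `‖A* 1‖ ≤ ‖A 1‖` (`norm_star_apply_one_le`); with
Parseval and an exchange of sums this yields traciality. The value on `Θ_{x,y}` is the expansion of
`⟨y, x⟩` in the frame (`hasSum_inner_rankOneEnd`). Cutting by the frame projections, which have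
finite trace, gives semifiniteness of the trace and of `N`.

The generator. The frame is homogeneous, so `D` is diagonal for the frame projections, with the
degrees as eigenvalues (`mem_closure_generatorGraph_iff`). A unitary of `N'` commutes with these
projections and therefore preserves the graph of `D`. -/

lemma Ultrafilter.tendsto_limUnder_of_bounded {ι : Type*} (U : Ultrafilter ι) {f : ι → ℂ} {C : ℝ}
    (h : ∀ᶠ i in U, ‖f i‖ ≤ C) : Tendsto f U (𝓝 (limUnder U f)) := by
  refine tendsto_nhds_limUnder ?_
  obtain ⟨z, -, hz⟩ := (isCompact_closedBall (0 : ℂ) C).ultrafilter_le_nhds (U.map f)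
    (by simpa [Filter.Eventually, Metric.closedBall, Set.preimage] using h)
  exact ⟨z, hz⟩

section Vigier

variable {H : Type*} [NormedAddCommGroup H] [InnerProductSpace ℂ H]

lemma ContinuousLinearMap.inner_apply_le {S T : H →L[ℂ] H} (h : S ≤ T) (v : H) :
    ⟪S v, v⟫_ℂ ≤ ⟪T v, v⟫_ℂ := by
  have := ((ContinuousLinearMap.le_def S T).1 h).inner_nonneg_left v
  rw [sub_apply, inner_sub_left] at this
  exact sub_nonneg.1 this

variable [CompleteSpace H]

/-- The weak limit of a bounded net of operators along an ultrafilter. -/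
lemma exists_weak_limit {ι : Type*} (U : Ultrafilter ι) (F : ι → H →L[ℂ] H) {C : ℝ}
    (h : ∀ᶠ i in U, ‖F i‖ ≤ C) :
    ∃ T : H →L[ℂ] H, ∀ v w, Tendsto (fun i => ⟪F i v, w⟫_ℂ) U (𝓝 ⟪T v, w⟫_ℂ) := by
  have hb : ∀ v w : H, ∀ᶠ i in U, ‖⟪F i v, w⟫_ℂ‖ ≤ C * ‖v‖ * ‖w‖ := fun v w => by
    filter_upwards [h] with i hi
    calc ‖⟪F i v, w⟫_ℂ‖ ≤ ‖F i v‖ * ‖w‖ := norm_inner_le_norm _ _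
      _ ≤ C * ‖v‖ * ‖w‖ := by gcongr; exact (F i).le_of_opNorm_le hi v
  have ht := fun v w => U.tendsto_limUnder_of_bounded (hb v w)
  let B : H →ₗ⋆[ℂ] H →ₗ[ℂ] ℂ := LinearMap.mk₂'ₛₗ (starRingEnd ℂ) (RingHom.id ℂ)
    (fun v w => limUnder U fun i => ⟪F i v, w⟫_ℂ)
    (fun v v' w => (((ht v w).add (ht v' w)).congr fun i => by
      rw [map_add, inner_add_left]).limUnder_eq)
    (fun c v w => (((ht v w).const_mul (starRingEnd ℂ c)).congr fun i => by
      rw [map_smul, inner_smul_left]).limUnder_eq)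
    (fun v w w' => (((ht v w).add (ht v w')).congr fun i => by
      rw [inner_add_right]).limUnder_eq)
    (fun c v w => (((ht v w).const_mul c).congr fun i => by
      rw [inner_smul_right]).limUnder_eq)
  refine ⟨InnerProductSpace.continuousLinearMapOfBilin (B.mkContinuous₂ C fun v w =>
    le_of_tendsto (ht v w).norm (hb v w)), fun v w => ?_⟩
  rw [InnerProductSpace.continuousLinearMapOfBilin_apply]
  exact ht v w

/-- Vector states are normal: they preserve suprema of bounded increasing nets of positive
operators. -/
theorem ofReal_inner_eq_iSup {s : Set (H →L[ℂ] H)} {T : H →L[ℂ] H} (hne : s.Nonempty)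
    (hdir : DirectedOn (· ≤ ·) s) (hpos : ∀ S ∈ s, 0 ≤ S) (hT : IsLUB s T) (v : H) :
    ENNReal.ofReal (⟪T v, v⟫_ℂ).re = ⨆ S ∈ s, ENNReal.ofReal (⟪S v, v⟫_ℂ).re := by
  have hmono : ∀ {S S' : H →L[ℂ] H}, S ≤ S' → (⟪S v, v⟫_ℂ).re ≤ (⟪S' v, v⟫_ℂ).re := fun h =>
    (ContinuousLinearMap.inner_apply_le h v).1
  refine le_antisymm ?_ (iSup₂_le fun S hS => ENNReal.ofReal_le_ofReal (hmono (hT.1 hS)))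
  have : Nonempty s := hne.to_subtype
  have : IsDirected s (· ≤ ·) := ⟨fun a b => by
    obtain ⟨c, hc, h⟩ := hdir a a.2 b b.2
    exact ⟨⟨c, hc⟩, h⟩⟩
  -- A weak limit along an ultrafilter finer than the order filter is an upper bound of `s`, so it
  -- dominates the least one, while its quadratic form at `v` cannot exceed the supremum.
  let U : Ultrafilter s := Ultrafilter.of atTop
  have hU : (U : Filter s) ≤ atTop := Ultrafilter.of_le atTop
  obtain ⟨T', hT'⟩ := exists_weak_limit U (fun S : s => (S : H →L[ℂ] H)) (C := ‖T‖)
    (Eventually.of_forall fun S => CStarAlgebra.norm_le_norm_of_nonneg_of_le (hpos S S.2)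
      (hT.1 S.2))
  have hub : T' ∈ upperBounds s := fun S hS => by
    rw [ContinuousLinearMap.le_def, ContinuousLinearMap.isPositive_iff_complex]
    suffices h : ∀ x, 0 ≤ ⟪(T' - S) x, x⟫_ℂ by
      intro x
      have := h x
      rw [Complex.nonneg_iff] at this
      exact ⟨Complex.ext rfl this.2, this.1⟩
    intro x
    rw [sub_apply, inner_sub_left, sub_nonneg]
    refine ge_of_tendsto (hT' x x) ?_
    filter_upwards [hU (Ici_mem_atTop (⟨S, hS⟩ : s))] with S' hS'
    exact ContinuousLinearMap.inner_apply_le hS' x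
  refine (ENNReal.ofReal_le_ofReal (hmono (hT.2 hub))).trans ?_
  have h1 : Tendsto (fun S : s => ENNReal.ofReal (⟪(S : H →L[ℂ] H) v, v⟫_ℂ).re) U
      (𝓝 (ENNReal.ofReal (⟪T' v, v⟫_ℂ).re)) :=
    (ENNReal.continuous_ofReal.tendsto _).comp ((Complex.continuous_re.tendsto _).comp (hT' v v))
  exact le_of_tendsto' h1 fun S => le_iSup₂_of_le (S : H →L[ℂ] H) S.2 le_rfl

end Vigier

/-! ### A Cuntz family on the space of square summable sequences -/

namespace SeqHilbert

/-- The standard basis vectors. -/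
noncomputable def basis (m : ℕ) : SeqHilbert := lp.single 2 m (1 : ℂ)

lemma inner_basis_left (m : ℕ) (f : SeqHilbert) : ⟪basis m, f⟫_ℂ = f m := by
  rw [basis, lp.inner_single_left]
  simp

lemma orthonormal_basis : Orthonormal ℂ basis := by
  rw [orthonormal_iff_ite]
  intro i j
  rw [inner_basis_left, basis, lp.single_apply, Pi.single_apply]

lemma ext_basis {S T : SeqHilbert →L[ℂ] SeqHilbert} (h : ∀ m, S (basis m) = T (basis m)) :
    S = T := by
  have hd : Dense (Submodule.span ℂ (Set.range basis) : Set SeqHilbert) := by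
    rw [Submodule.dense_iff_topologicalClosure_eq_top,
      Submodule.topologicalClosure_eq_top_iff, Submodule.eq_bot_iff]
    intro f hf
    refine lp.ext (funext fun m => ?_)
    rw [← inner_basis_left]
    exact hf _ (Submodule.subset_span ⟨m, rfl⟩)
  exact ContinuousLinearMap.ext_on hd (by rintro _ ⟨m, rfl⟩; exact h m)

/-- The isometry of `ℓ²(ℕ)` induced by an injective map of the index set. -/
noncomputable def shift (j : ℕ → ℕ) (hj : j.Injective) : SeqHilbert →ₗᵢ[ℂ] SeqHilbert :=
  OrthogonalFamily.linearIsometry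
    ((orthonormal_basis.comp j hj).orthogonalFamily)

lemma shift_basis (j : ℕ → ℕ) (hj : j.Injective) (m : ℕ) : shift j hj (basis m) = basis (j m) := by
  rw [shift, basis, OrthogonalFamily.linearIsometry_apply_single]
  simp

lemma star_mul_shift (j : ℕ → ℕ) (hj : j.Injective) :
    star (shift j hj).toContinuousLinearMap * (shift j hj).toContinuousLinearMap = 1 :=
  ContinuousLinearMap.norm_map_iff_adjoint_comp_self _ |>.1 fun x => (shift j hj).norm_map x

lemma star_shift_basis (j : ℕ → ℕ) (hj : j.Injective) (m : ℕ) :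
    star (shift j hj).toContinuousLinearMap (basis (j m)) = basis m := by
  rw [← shift_basis j hj m]
  exact congrArg (fun T : SeqHilbert →L[ℂ] SeqHilbert => T (basis m)) (star_mul_shift j hj)

lemma star_shift_basis_of_notMem (j : ℕ → ℕ) (hj : j.Injective) {k : ℕ} (hk : ∀ m, j m ≠ k) :
    star (shift j hj).toContinuousLinearMap (basis k) = 0 := by
  refine lp.ext (funext fun m => ?_)
  rw [← inner_basis_left, ContinuousLinearMap.star_eq_adjoint,
    ContinuousLinearMap.adjoint_inner_right]
  change ⟪shift j hj (basis m), basis k⟫_ℂ = 0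
  rw [shift_basis]
  exact orthonormal_basis.2 (hk m)

end SeqHilbert

open SeqHilbert in
-- The injections `m ↦ n m + i`, for `i < n`, have disjoint ranges covering `ℕ` (residue classes),
-- so the isometries they induce form a Cuntz family. Without one, `O_n` would be zero and `F` would
-- have no state.
lemma CuntzFamily.nonempty {n : ℕ} (hn : 0 < n) : Nonempty (CuntzFamily n) := by
  have hinj : ∀ i : Fin n, Function.Injective fun m : ℕ => n * m + i := fun i a b h => by
    simpa [hn.ne'] using h
  refine ⟨⟨fun i => (shift _ (hinj i)).toContinuousLinearMap, fun i => star_mul_shift _ _, ?_⟩⟩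
  refine ext_basis fun k => ?_
  have hk : n * (k / n) + ((⟨k % n, Nat.mod_lt k hn⟩ : Fin n) : ℕ) = k := Nat.div_add_mod k n
  rw [sum_apply, Finset.sum_eq_single ⟨k % n, Nat.mod_lt k hn⟩]
  · rw [mul_apply_eq_comp]
    have h := star_shift_basis _ (hinj ⟨k % n, Nat.mod_lt k hn⟩) (k / n)
    rw [hk] at h
    rw [h]
    exact (shift_basis _ (hinj ⟨k % n, Nat.mod_lt k hn⟩) _).trans (congrArg basis hk)
  · intro i _ hi
    rw [mul_apply_eq_comp, star_shift_basis_of_notMem, map_zero]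
    rintro m rfl
    apply hi
    apply Fin.ext
    simp [Nat.mod_eq_of_lt i.2]
  · simp

end

namespace CuntzAlgebra

/-! ### Words in the generators -/

section Words

variable {n : ℕ}

/-- Conjugating `∑ S_k S_k* = 1` by `S_j` gives `∑ (S_k* S_j)* (S_k* S_j) = 1`. The term `k = j` is
already `1`, so the remaining positive terms vanish. -/
lemma star_gen_mul_gen_of_ne {i j : Fin n} (h : i ≠ j) :
    star (gen i) * gen j = (0 : CuntzAlgebra n) := by
  have h1 : ∑ k ∈ Finset.univ.erase j,
      star (star (gen k) * gen j) * (star (gen k) * gen j) = (0 : CuntzAlgebra n) := by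
    have h2 : ∑ k : Fin n, star (star (gen k) * gen j) * (star (gen k) * gen j) =
        (1 : CuntzAlgebra n) := by
      simp only [star_mul, star_star]
      have h3 : ∀ k : Fin n, star (gen j) * gen k * (star (gen k) * gen j) =
          star (gen j) * (gen k * star (gen k)) * (gen j : CuntzAlgebra n) := fun k => by
        simp only [mul_assoc]
      simp only [h3]
      rw [← Finset.sum_mul, ← Finset.mul_sum, sum_gen_mul_star, mul_one, star_gen_mul_gen]
    rw [← Finset.add_sum_erase _ _ (Finset.mem_univ j), star_gen_mul_gen] at h2
    simpa using h2
  have h4 := (Finset.sum_eq_zero_iff_of_nonneg fun k _ => star_mul_self_nonneg _).1 h1 i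
    (Finset.mem_erase.2 ⟨h, Finset.mem_univ i⟩)
  exact (CStarRing.star_mul_self_eq_zero_iff _).1 h4

/-- The isometry `S_μ` of a word `μ`. -/
noncomputable def word (μ : List (Fin n)) : CuntzAlgebra n := (μ.map gen).prod

@[simp] lemma word_nil : word ([] : List (Fin n)) = 1 := rfl

@[simp] lemma word_cons (i : Fin n) (μ : List (Fin n)) : word (i :: μ) = gen i * word μ := by
  simp [word]

lemma word_append (μ ν : List (Fin n)) : word (μ ++ ν) = word μ * word ν := by
  simp [word]

lemma monomial_eq (μ ν : List (Fin n)) : monomial μ ν = word μ * star (word ν) := rfl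

@[simp] lemma star_word_mul_word (μ : List (Fin n)) : star (word μ) * word μ = 1 := by
  induction μ with
  | nil => simp
  | cons i μ ih =>
    rw [word_cons, star_mul, mul_assoc, ← mul_assoc (star (gen i)), star_gen_mul_gen, one_mul, ih]

lemma star_word_mul_word_of_ne {μ ν : List (Fin n)} (hl : μ.length = ν.length) (h : μ ≠ ν) :
    star (word μ) * word ν = 0 := by
  induction μ generalizing ν with
  | nil => exact absurd (List.length_eq_zero_iff.1 hl.symm).symm h
  | cons i μ ih =>
    cases ν with
    | nil => simp at hl
    | cons j ν =>
      rw [word_cons, word_cons, star_mul, mul_assoc, ← mul_assoc (star (gen i))]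
      by_cases hij : i = j
      · subst hij
        rw [star_gen_mul_gen, one_mul]
        exact ih (by simpa using hl) (fun h' => h (by rw [h']))
      · rw [star_gen_mul_gen_of_ne hij, zero_mul, mul_zero]

/-! ### Density of `algSpan` -/

lemma monomial_mem_algSpan (μ ν : List (Fin n)) : monomial μ ν ∈ algSpan n :=
  Submodule.subset_span ⟨μ, ν, rfl⟩

lemma word_mem_algSpan (μ : List (Fin n)) : word μ ∈ algSpan n := by
  simpa [monomial_eq] using monomial_mem_algSpan μ []

lemma star_word_mem_algSpan (μ : List (Fin n)) : star (word μ) ∈ algSpan n := by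
  simpa [monomial_eq] using monomial_mem_algSpan [] μ

lemma mul_mem_algSpan_of_monomial {a : CuntzAlgebra n}
    (h : ∀ μ ν, a * monomial μ ν ∈ algSpan n) {x : CuntzAlgebra n} (hx : x ∈ algSpan n) :
    a * x ∈ algSpan n := by
  induction hx using Submodule.span_induction with
  | mem x hx => obtain ⟨μ, ν, rfl⟩ := hx; exact h μ ν
  | zero => simp
  | add x y _ _ hx hy => rw [mul_add]; exact add_mem hx hy
  | smul c x _ hx => rw [mul_smul_comm]; exact Submodule.smul_mem _ _ hx

lemma gen_mul_mem_algSpan (i : Fin n) {x : CuntzAlgebra n} (hx : x ∈ algSpan n) :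
    gen i * x ∈ algSpan n :=
  mul_mem_algSpan_of_monomial (fun μ ν => by
    simpa [monomial_eq, mul_assoc] using monomial_mem_algSpan (i :: μ) ν) hx

lemma star_gen_mul_mem_algSpan (i : Fin n) {x : CuntzAlgebra n} (hx : x ∈ algSpan n) :
    star (gen i) * x ∈ algSpan n := by
  refine mul_mem_algSpan_of_monomial (fun μ ν => ?_) hx
  cases μ with
  | nil => simpa [monomial_eq, word_append] using monomial_mem_algSpan [] (ν ++ [i])
  | cons j μ =>
    rw [monomial_eq, word_cons, mul_assoc, ← mul_assoc]
    by_cases hij : i = j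
    · subst hij
      rw [star_gen_mul_gen, one_mul]
      exact monomial_mem_algSpan μ ν
    · rw [star_gen_mul_gen_of_ne hij, zero_mul]
      exact zero_mem _

/-- The elements whose left multiplication preserves `algSpan` form an algebra containing the
generators and their adjoints; applying them to `1` puts the star algebra generated by the `Sᵢ`
inside `algSpan`. -/
lemma dense_algSpan : Dense (algSpan n : Set (CuntzAlgebra n)) := by
  have h1 : ∀ b ∈ Algebra.adjoin ℂ (Set.range (cuntzAmbientGen n) ∪
      star (Set.range (cuntzAmbientGen n))),
      ∃ a : CuntzAlgebra n, a.1 = b ∧ ∀ x ∈ algSpan n, a * x ∈ algSpan n := by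
    intro b hb
    induction hb using Algebra.adjoin_induction with
    | mem b hb =>
      rcases hb with ⟨i, rfl⟩ | ⟨i, hi⟩
      · exact ⟨gen i, rfl, fun x hx => gen_mul_mem_algSpan i hx⟩
      · refine ⟨star (gen i), ?_, fun x hx => star_gen_mul_mem_algSpan i hx⟩
        rw [← star_star b, ← hi]
        rfl
    | algebraMap c =>
      refine ⟨algebraMap ℂ _ c, rfl, fun x hx => ?_⟩
      rw [← Algebra.smul_def]
      exact Submodule.smul_mem _ _ hx
    | add b b' _ _ h h' =>
      obtain ⟨a, rfl, ha⟩ := h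
      obtain ⟨a', rfl, ha'⟩ := h'
      exact ⟨a + a', rfl, fun x hx => by rw [add_mul]; exact add_mem (ha x hx) (ha' x hx)⟩
    | mul b b' _ _ h h' =>
      obtain ⟨a, rfl, ha⟩ := h
      obtain ⟨a', rfl, ha'⟩ := h'
      exact ⟨a * a', rfl, fun x hx => by rw [mul_assoc]; exact ha _ (ha' x hx)⟩
  intro a
  rw [Metric.mem_closure_iff]
  intro ε hε
  obtain ⟨b, hb, hab⟩ := Metric.mem_closure_iff.1 (show a.1 ∈ closure
    (StarAlgebra.adjoin ℂ (Set.range (cuntzAmbientGen n)) : Set (CuntzAmbient n)) from a.2) ε hε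
  obtain ⟨a', rfl, ha'⟩ := h1 b hb
  refine ⟨a', ?_, hab⟩
  have := ha' 1 (by simpa using word_mem_algSpan ([] : List (Fin n)))
  rwa [mul_one] at this

end Words

/-! ### Homogeneous elements and the conditional expectation -/

section Homogeneous

variable {n : ℕ}

/-- The elements of degree `d` for the gauge action. -/
def IsHomogeneous (d : ℤ) (a : CuntzAlgebra n) : Prop :=
  ∀ z : Circle, gauge z a = (z : ℂ) ^ d • a

lemma IsHomogeneous.mul {d e : ℤ} {a b : CuntzAlgebra n} (ha : IsHomogeneous d a)
    (hb : IsHomogeneous e b) : IsHomogeneous (d + e) (a * b) := fun z => by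
  rw [map_mul, ha z, hb z, smul_mul_smul_comm, zpow_add₀ (Circle.coe_ne_zero z)]

lemma IsHomogeneous.star {d : ℤ} {a : CuntzAlgebra n} (ha : IsHomogeneous d a) :
    IsHomogeneous (-d) (star a) := fun z => by
  rw [map_star, ha z, star_smul, zpow_neg, ← inv_zpow, ← Circle.coe_inv, Circle.coe_inv_eq_conj,
    ← starRingEnd_apply, map_zpow₀]

lemma isHomogeneous_zero_iff {a : CuntzAlgebra n} : IsHomogeneous 0 a ↔ a ∈ core n := by
  refine forall_congr' fun z => ?_
  rw [zpow_zero, one_smul]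

lemma isHomogeneous_word (μ : List (Fin n)) : IsHomogeneous (μ.length : ℤ) (word μ) := by
  induction μ with
  | nil => exact isHomogeneous_zero_iff.2 (one_mem _)
  | cons i μ ih =>
    have h : IsHomogeneous (1 : ℤ) (gen i : CuntzAlgebra n) := fun z => by
      rw [gauge_gen, zpow_one]
    have := h.mul ih
    rw [word_cons, List.length_cons, Nat.cast_succ, add_comm]
    exact this

lemma isHomogeneous_monomial (μ ν : List (Fin n)) :
    IsHomogeneous ((μ.length : ℤ) - ν.length) (monomial μ ν) :=
  (isHomogeneous_word μ).mul (isHomogeneous_word ν).star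

lemma monomial_mem_core {μ ν : List (Fin n)} (h : μ.length = ν.length) :
    monomial μ ν ∈ core n := by
  have := isHomogeneous_monomial μ ν
  rwa [h, sub_self, isHomogeneous_zero_iff] at this

lemma gaugeMean_of_mem {a : CuntzAlgebra n} (ha : a ∈ core n) : gaugeMean a = a := by
  have h : ∀ z : Circle, gauge z a = a := ha
  simp only [gaugeMean, h, intervalIntegral.integral_const, sub_zero]
  rw [smul_smul, inv_mul_cancel₀ Real.two_pi_pos.ne', one_smul]

lemma gaugeMean_of_isHomogeneous {d : ℤ} (hd : d ≠ 0) {a : CuntzAlgebra n}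
    (ha : IsHomogeneous d a) : gaugeMean a = 0 := by
  have h1 : ∀ θ : ℝ, gauge (Circle.exp θ) a = Complex.exp (d * Complex.I * θ) • a := fun θ => by
    rw [ha, Circle.coe_exp, ← Complex.exp_int_mul]
    congr 2
    ring
  simp only [gaugeMean, h1]
  have h2 : (d * Complex.I : ℂ) ≠ 0 := by simp [hd]
  have h3 : Complex.exp (d * Complex.I * ((2 * Real.pi : ℝ) : ℂ)) = 1 := by
    rw [← Complex.exp_int_mul_two_pi_mul_I d]
    push_cast
    ring_nf
  rw [intervalIntegral.integral_smul_const, integral_exp_mul_complex h2, h3]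
  simp

lemma gaugeMean_star (a : CuntzAlgebra n) : gaugeMean (star a) = star (gaugeMean a) := by
  have h : ∀ θ : ℝ, gauge (Circle.exp θ) (star a) =
      (starL' ℝ : CuntzAlgebra n ≃L[ℝ] CuntzAlgebra n).toContinuousLinearMap
        (gauge (Circle.exp θ) a) := fun θ => map_star _ _
  simp only [gaugeMean, h]
  rw [ContinuousLinearMap.intervalIntegral_comp_comm _
    ((continuous_gauge_exp a).intervalIntegrable _ _), star_smul]
  rfl

lemma gaugeMean_mul_right (a : CuntzAlgebra n) {f : CuntzAlgebra n} (hf : f ∈ core n) :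
    gaugeMean (a * f) = gaugeMean a * f := by
  rw [← star_star (a * f), gaugeMean_star, star_mul, gaugeMean_mul (star_mem hf), star_mul,
    star_star, gaugeMean_star, star_star]

lemma gaugeMean_sub (a b : CuntzAlgebra n) : gaugeMean (a - b) = gaugeMean a - gaugeMean b := by
  rw [sub_eq_add_neg, ← neg_one_smul ℂ b, gaugeMean_add, gaugeMean_smul, neg_one_smul,
    sub_eq_add_neg]

lemma norm_gaugeMean_le (a : CuntzAlgebra n) : ‖gaugeMean a‖ ≤ ‖a‖ := by
  have h := intervalIntegral.norm_integral_le_of_norm_le_const (a := 0) (b := 2 * Real.pi)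
    (f := fun θ : ℝ => gauge (Circle.exp θ) a) (C := ‖a‖)
    fun θ _ => NonUnitalStarAlgHom.norm_apply_le (gauge (Circle.exp θ)) a
  rw [sub_zero, abs_of_pos Real.two_pi_pos] at h
  rw [gaugeMean, norm_smul, norm_inv, Real.norm_of_nonneg Real.two_pi_pos.le,
    inv_mul_le_iff₀ Real.two_pi_pos]
  exact h.trans_eq (mul_comm _ _)

lemma expectation_mul_right (a : CuntzAlgebra n) (f : core n) :
    expectation n (a * f) = expectation n a * f :=
  Subtype.ext (gaugeMean_mul_right a f.2)

lemma expectation_mul_left (f : core n) (a : CuntzAlgebra n) :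
    expectation n (f * a) = f * expectation n a :=
  Subtype.ext (gaugeMean_mul f.2 a)

lemma expectation_coe (f : core n) : expectation n (f : CuntzAlgebra n) = f :=
  Subtype.ext (gaugeMean_of_mem f.2)

/-- The span of the monomials `S_μ S_ν*` with `|μ| = |ν|`. -/
noncomputable def coreSpan (n : ℕ) : Submodule ℂ (CuntzAlgebra n) :=
  Submodule.span ℂ {a | ∃ μ ν : List (Fin n), μ.length = ν.length ∧ a = monomial μ ν}

lemma gaugeMean_mem_coreSpan {a : CuntzAlgebra n} (ha : a ∈ algSpan n) :
    gaugeMean a ∈ coreSpan n := by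
  induction ha using Submodule.span_induction with
  | mem x hx =>
    obtain ⟨μ, ν, rfl⟩ := hx
    by_cases h : μ.length = ν.length
    · rw [gaugeMean_of_mem (monomial_mem_core h)]
      exact Submodule.subset_span ⟨μ, ν, h, rfl⟩
    · rw [gaugeMean_of_isHomogeneous (by omega) (isHomogeneous_monomial μ ν)]
      exact zero_mem _
  | zero => rw [gaugeMean_of_mem (zero_mem (core n))]; exact zero_mem _
  | add x y _ _ hx hy => rw [gaugeMean_add]; exact add_mem hx hy
  | smul c x _ hx => rw [gaugeMean_smul]; exact Submodule.smul_mem _ _ hx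

/-- The expectation is a contraction fixing `F`, and it keeps exactly the monomials of degree zero;
applied to an approximation from `algSpan` it gives one from `coreSpan`. -/
lemma core_subset_closure_coreSpan :
    (core n : Set (CuntzAlgebra n)) ⊆ closure (coreSpan n : Set (CuntzAlgebra n)) := by
  intro a ha
  rw [Metric.mem_closure_iff]
  intro ε hε
  obtain ⟨b, hb, hab⟩ := Metric.mem_closure_iff.1 (dense_algSpan a) ε hε
  refine ⟨gaugeMean b, gaugeMean_mem_coreSpan hb, lt_of_le_of_lt ?_ hab⟩
  rw [dist_eq_norm, dist_eq_norm, ← gaugeMean_of_mem ha, ← gaugeMean_sub]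
  exact (norm_gaugeMean_le _).trans_eq (by rw [gaugeMean_of_mem ha])

end Homogeneous

end CuntzAlgebra

section

open Filter Topology

namespace CuntzAlgebra

/-! ### The matrix subalgebras of the core -/

section Tower

variable {n : ℕ}

/-- Inserting `∑ S_l S_l* = 1` between `a` and `b` shows that the entries `Sᵢ* a Sⱼ` multiply like
those of a matrix. -/
lemma star_gen_mul_mul_mul_gen (a b : CuntzAlgebra n) (i j : Fin n) :
    star (gen i) * (a * b) * gen j =
      ∑ l, (star (gen i) * a * gen l) * (star (gen l) * b * gen j) := by
  have h : ∀ l : Fin n, (star (gen i) * a * gen l) * (star (gen l) * b * gen j) =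
      star (gen i) * a * (gen l * star (gen l)) * (b * gen j : CuntzAlgebra n) := fun l => by
    simp only [mul_assoc]
  simp only [h]
  rw [← Finset.sum_mul, ← Finset.mul_sum, sum_gen_mul_star, mul_one]
  simp only [mul_assoc]

lemma eq_sum_gen_mul_mul_star (a : CuntzAlgebra n) :
    a = ∑ i, ∑ j, gen i * (star (gen i) * a * gen j) * star (gen j) := by
  have h : ∀ i j : Fin n, gen i * (star (gen i) * a * gen j) * star (gen j) =
      (gen i * star (gen i) * a) * (gen j * star (gen j) : CuntzAlgebra n) := fun i j => by
    simp only [mul_assoc]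
  simp only [h, ← Finset.mul_sum, ← Finset.sum_mul, sum_gen_mul_star, mul_one, one_mul]

lemma star_gen_mul_algebraMap_mul_gen (i j : Fin n) (c : ℂ) :
    star (gen i) * algebraMap ℂ (CuntzAlgebra n) c * gen j =
      algebraMap ℂ (CuntzAlgebra n) (if i = j then c else 0) := by
  rw [← Algebra.commutes, mul_assoc]
  split_ifs with h
  · subst h
    rw [star_gen_mul_gen, mul_one]
  · rw [star_gen_mul_gen_of_ne h, mul_zero, map_zero]

/-- The subalgebra spanned by the `S_μ S_ν*` with `|μ| = |ν| = k`, a copy of the `n ^ k × n ^ k`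
matrices: its elements are those all of whose matrix entries `S_μ* a S_ν` are scalars. -/
noncomputable def matrixAlg (n : ℕ) : ℕ → StarSubalgebra ℂ (CuntzAlgebra n)
  | 0 => ⊥
  | k + 1 =>
    { carrier := {a | ∀ i j : Fin n, star (gen i) * a * gen j ∈ matrixAlg n k}
      mul_mem' := fun {a b} ha hb i j => by
        rw [star_gen_mul_mul_mul_gen]
        exact sum_mem fun l _ => mul_mem (ha i l) (hb l j)
      add_mem' := fun {a b} ha hb i j => by
        rw [mul_add, add_mul]
        exact add_mem (ha i j) (hb i j)
      algebraMap_mem' := fun c i j => by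
        rw [star_gen_mul_algebraMap_mul_gen]
        exact algebraMap_mem _ _
      star_mem' := fun {a} ha i j => by
        have := star_mem (ha j i)
        rwa [star_mul, star_mul, star_star, ← mul_assoc] at this }

lemma mem_matrixAlg_zero {a : CuntzAlgebra n} : a ∈ matrixAlg n 0 ↔ ∃ c : ℂ, algebraMap ℂ _ c = a :=
  StarSubalgebra.mem_bot

lemma mem_matrixAlg_succ {k : ℕ} {a : CuntzAlgebra n} :
    a ∈ matrixAlg n (k + 1) ↔ ∀ i j : Fin n, star (gen i) * a * gen j ∈ matrixAlg n k := Iff.rfl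

/-- Closedness makes `matrixAlg n k` a C⋆-algebra, so that an injective representation of it is
isometric. -/
lemma isClosed_matrixAlg (k : ℕ) : IsClosed (matrixAlg n k : Set (CuntzAlgebra n)) := by
  induction k with
  | zero =>
    have h := Submodule.closed_of_finiteDimensional
      (LinearMap.range (Algebra.linearMap ℂ (CuntzAlgebra n)))
    convert h using 1
    ext a
    exact mem_matrixAlg_zero
  | succ k ih =>
    have h : (matrixAlg n (k + 1) : Set (CuntzAlgebra n)) =
        ⋂ i : Fin n, ⋂ j : Fin n, (fun a => star (gen i) * a * gen j) ⁻¹' (matrixAlg n k) := by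
      ext a
      simp [mem_matrixAlg_succ]
    rw [h]
    exact isClosed_iInter fun i => isClosed_iInter fun j => ih.preimage (by fun_prop)

lemma matrixAlg_mono : Monotone (matrixAlg n) := by
  refine monotone_nat_of_le_succ fun k => ?_
  induction k with
  | zero =>
    intro a ha i j
    obtain ⟨c, rfl⟩ := mem_matrixAlg_zero.1 ha
    rw [star_gen_mul_algebraMap_mul_gen]
    exact algebraMap_mem _ _
  | succ k ih => exact fun a ha i j => ih (ha i j)

lemma isHomogeneous_gen (i : Fin n) : IsHomogeneous 1 (gen i : CuntzAlgebra n) := by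
  simpa using isHomogeneous_word [i]

lemma gen_mul_mul_star_gen_mem_core {a : CuntzAlgebra n} (ha : a ∈ core n) (i j : Fin n) :
    gen i * a * star (gen j) ∈ core n := by
  have := ((isHomogeneous_gen i).mul (isHomogeneous_zero_iff.2 ha)).mul (isHomogeneous_gen j).star
  rwa [add_zero, add_neg_cancel, isHomogeneous_zero_iff] at this

lemma matrixAlg_le_core (k : ℕ) : matrixAlg n k ≤ core n := by
  induction k with
  | zero =>
    intro a ha
    obtain ⟨c, rfl⟩ := mem_matrixAlg_zero.1 ha
    exact algebraMap_mem _ _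
  | succ k ih =>
    intro a ha
    rw [eq_sum_gen_mul_mul_star a]
    exact sum_mem fun i _ => sum_mem fun j _ => gen_mul_mul_star_gen_mem_core (ih (ha i j)) i j

lemma monomial_mem_matrixAlg {μ ν : List (Fin n)} (h : μ.length = ν.length) :
    monomial μ ν ∈ matrixAlg n μ.length := by
  induction μ generalizing ν with
  | nil =>
    obtain rfl := List.length_eq_zero_iff.1 h.symm
    simp [monomial_eq]
  | cons i μ ih =>
    cases ν with
    | nil => simp at h
    | cons j ν =>
      intro i' j'
      have h1 : star (gen i') * monomial (i :: μ) (j :: ν) * gen j' =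
          (star (gen i') * gen i) * monomial μ ν * (star (gen j) * gen j') := by
        simp only [monomial_eq, word_cons, star_mul, mul_assoc]
      rw [h1]
      by_cases hi : i' = i
      · by_cases hj : j = j'
        · rw [hi, hj, star_gen_mul_gen, star_gen_mul_gen, one_mul, mul_one]
          exact ih (by simpa using h)
        · rw [star_gen_mul_gen_of_ne hj, mul_zero]
          exact zero_mem _
      · rw [star_gen_mul_gen_of_ne hi, zero_mul, zero_mul]
        exact zero_mem _

lemma exists_mem_matrixAlg {a : CuntzAlgebra n} (ha : a ∈ coreSpan n) :
    ∃ k, a ∈ matrixAlg n k := by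
  induction ha using Submodule.span_induction with
  | mem x hx =>
    obtain ⟨μ, ν, h, rfl⟩ := hx
    exact ⟨_, monomial_mem_matrixAlg h⟩
  | zero => exact ⟨0, zero_mem _⟩
  | add x y _ _ hx hy =>
    obtain ⟨k, hk⟩ := hx
    obtain ⟨l, hl⟩ := hy
    exact ⟨max k l, add_mem (matrixAlg_mono (le_max_left k l) hk)
      (matrixAlg_mono (le_max_right k l) hl)⟩
  | smul c x _ hx =>
    obtain ⟨k, hk⟩ := hx
    exact ⟨k, SMulMemClass.smul_mem c hk⟩

lemma core_subset_closure_iUnion_matrixAlg :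
    (core n : Set (CuntzAlgebra n)) ⊆ closure (⋃ k, (matrixAlg n k : Set (CuntzAlgebra n))) :=
  core_subset_closure_coreSpan.trans (closure_mono fun _ ha =>
    Set.mem_iUnion.2 (exists_mem_matrixAlg ha))

end Tower

/-! ### The averaging map and the trace -/

section Average

variable {n : ℕ}

/-- The unital positive map `a ↦ n⁻¹ ∑ Sᵢ* a Sᵢ`. -/
noncomputable def average (n : ℕ) : Module.End ℂ (CuntzAlgebra n) :=
  (n : ℂ)⁻¹ • ∑ i : Fin n, (LinearMap.mulRight ℂ (gen i)) ∘ₗ LinearMap.mulLeft ℂ (star (gen i))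

lemma average_apply (a : CuntzAlgebra n) :
    average n a = (n : ℂ)⁻¹ • ∑ i : Fin n, star (gen i) * a * gen i := by
  simp [average]

lemma average_algebraMap (hn : n ≠ 0) (c : ℂ) :
    average n (algebraMap ℂ (CuntzAlgebra n) c) = algebraMap ℂ _ c := by
  simp only [average_apply, star_gen_mul_algebraMap_mul_gen, if_true, Finset.sum_const,
    Finset.card_univ, Fintype.card_fin]
  rw [← Nat.cast_smul_eq_nsmul ℂ, smul_smul, inv_mul_cancel₀ (Nat.cast_ne_zero.2 hn), one_smul]

lemma average_nonneg {a : CuntzAlgebra n} (ha : 0 ≤ a) : 0 ≤ average n a := by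
  rw [average_apply]
  exact smul_nonneg (by simp) (Finset.sum_nonneg fun i _ => star_left_conjugate_nonneg ha _)

lemma average_pow_nonneg (k : ℕ) {a : CuntzAlgebra n} (ha : 0 ≤ a) : 0 ≤ (average n ^ k) a := by
  induction k generalizing a with
  | zero => simpa using ha
  | succ k ih => rw [pow_succ, Module.End.mul_apply]; exact ih (average_nonneg ha)

lemma norm_gen_le_one (i : Fin n) : ‖(gen i : CuntzAlgebra n)‖ ≤ 1 := by
  have h := CStarRing.norm_star_mul_self (x := (gen i : CuntzAlgebra n))
  rw [star_gen_mul_gen] at h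
  rcases subsingleton_or_nontrivial (CuntzAlgebra n) with h0 | h0
  · rw [Subsingleton.elim (gen i) (0 : CuntzAlgebra n), norm_zero]
    exact zero_le_one
  · rw [norm_one] at h
    nlinarith [norm_nonneg (gen i : CuntzAlgebra n)]

lemma norm_average_le (hn : n ≠ 0) (a : CuntzAlgebra n) : ‖average n a‖ ≤ ‖a‖ := by
  have h1 : ∀ i : Fin n, ‖star (gen i) * a * gen i‖ ≤ ‖a‖ := fun i => by
    calc ‖star (gen i) * a * gen i‖ ≤ ‖(gen i : CuntzAlgebra n)‖ * ‖a‖ * ‖(gen i : CuntzAlgebra n)‖ := by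
          refine (norm_mul_le _ _).trans ?_
          gcongr
          exact (norm_mul_le _ _).trans_eq (by rw [norm_star])
      _ ≤ 1 * ‖a‖ * 1 := by gcongr <;> exact norm_gen_le_one i
      _ = ‖a‖ := by ring
  rw [average_apply, norm_smul, norm_inv, Complex.norm_natCast,
    inv_mul_le_iff₀ (by positivity)]
  exact (norm_sum_le_of_le _ fun i _ => h1 i).trans_eq (by simp)

lemma norm_average_pow_le (hn : n ≠ 0) (k : ℕ) (a : CuntzAlgebra n) :
    ‖(average n ^ k) a‖ ≤ ‖a‖ := by
  induction k generalizing a with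
  | zero => simp
  | succ k ih =>
    rw [pow_succ, Module.End.mul_apply]
    exact (ih _).trans (norm_average_le hn a)

lemma average_mem_matrixAlg {k : ℕ} {a : CuntzAlgebra n} (ha : a ∈ matrixAlg n (k + 1)) :
    average n a ∈ matrixAlg n k := by
  rw [average_apply]
  exact SMulMemClass.smul_mem _ (sum_mem fun i _ => ha i i)

lemma average_pow_mem_matrixAlg {k : ℕ} {a : CuntzAlgebra n} (ha : a ∈ matrixAlg n k) :
    (average n ^ k) a ∈ matrixAlg n 0 := by
  induction k generalizing a with
  | zero => simpa using ha
  | succ k ih => rw [pow_succ, Module.End.mul_apply]; exact ih (average_mem_matrixAlg ha)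

lemma average_pow_algebraMap (hn : n ≠ 0) (k : ℕ) (c : ℂ) :
    (average n ^ k) (algebraMap ℂ (CuntzAlgebra n) c) = algebraMap ℂ _ c := by
  induction k with
  | zero => simp
  | succ k ih => rw [pow_succ, Module.End.mul_apply, average_algebraMap hn, ih]

/-- After `k` steps the value is a scalar, which further averaging fixes. -/
lemma average_pow_eq_of_le (hn : n ≠ 0) {k m : ℕ} (hkm : k ≤ m) {a : CuntzAlgebra n}
    (ha : a ∈ matrixAlg n k) : (average n ^ m) a = (average n ^ k) a := by
  obtain ⟨c, hc⟩ := mem_matrixAlg_zero.1 (average_pow_mem_matrixAlg ha)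
  obtain ⟨d, rfl⟩ := Nat.exists_eq_add_of_le' hkm
  rw [pow_add, Module.End.mul_apply, ← hc, average_pow_algebraMap hn]

lemma average_mul (a b : CuntzAlgebra n) : average n (a * b) =
    (n : ℂ)⁻¹ • ∑ i : Fin n, ∑ l, (star (gen i) * a * gen l) * (star (gen l) * b * gen i) := by
  simp only [average_apply, star_gen_mul_mul_mul_gen]

/-- This is the proof that the trace of a matrix product is symmetric: sum the products of entries
in the other order, and use induction for the entries, which lie one level lower. -/
lemma average_pow_mul_comm {k : ℕ} {a b : CuntzAlgebra n} (ha : a ∈ matrixAlg n k)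
    (hb : b ∈ matrixAlg n k) : (average n ^ k) (a * b) = (average n ^ k) (b * a) := by
  induction k generalizing a b with
  | zero =>
    obtain ⟨c, rfl⟩ := mem_matrixAlg_zero.1 ha
    rw [Algebra.commutes]
  | succ k ih =>
    rw [pow_succ, Module.End.mul_apply, Module.End.mul_apply, average_mul, average_mul, map_smul,
      map_smul, Finset.sum_comm]
    refine congrArg _ ?_
    rw [map_sum, map_sum]
    refine Finset.sum_congr rfl fun l _ => ?_
    rw [map_sum, map_sum]
    exact Finset.sum_congr rfl fun i _ => ih (ha i l) (hb l i)

/-- The average of `a* a` is a positive multiple of the sum of the `b* b` over the entries `b` of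
`a`. All terms stay positive under further averaging, so each one vanishes and induction applies to
the entries. -/
lemma eq_zero_of_average_pow_eq_zero (hn : n ≠ 0) (k : ℕ) {a : CuntzAlgebra n}
    (h : (average n ^ k) (star a * a) = 0) : a = 0 := by
  induction k generalizing a with
  | zero => exact (CStarRing.star_mul_self_eq_zero_iff a).1 (by simpa using h)
  | succ k ih =>
    have h1 : ∀ i l : Fin n, star (gen i) * star a * gen l * (star (gen l) * a * gen i) =
        star (star (gen l) * a * gen i) * (star (gen l) * a * gen i) := fun i l => by
      simp only [star_mul, star_star, mul_assoc]
    rw [pow_succ, Module.End.mul_apply, average_mul, map_smul] at h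
    replace h := (smul_eq_zero.1 h).resolve_left (inv_ne_zero (Nat.cast_ne_zero.2 hn))
    simp only [h1, map_sum] at h
    have h2 : ∀ i l : Fin n, star (gen l) * a * gen i = 0 := fun i l => by
      have hpos : ∀ i l : Fin n, 0 ≤ (average n ^ k)
          (star (star (gen l) * a * gen i) * (star (gen l) * a * gen i)) := fun i l =>
        average_pow_nonneg k (star_mul_self_nonneg _)
      have h3 := (Finset.sum_eq_zero_iff_of_nonneg fun i _ =>
        Finset.sum_nonneg fun l _ => hpos i l).1 h i (Finset.mem_univ i)
      exact ih ((Finset.sum_eq_zero_iff_of_nonneg fun l _ => hpos i l).1 h3 l (Finset.mem_univ l))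
    rw [eq_sum_gen_mul_mul_star a]
    simp [h2]

/-- The coordinate projection of `O_n` at a Cuntz family, a representation on `ℓ²(ℕ)`. -/
noncomputable def eval (r : CuntzFamily n) :
    CuntzAlgebra n →⋆ₐ[ℂ] (SeqHilbert →L[ℂ] SeqHilbert) where
  toFun a := (a.1 : ∀ _ : CuntzFamily n, _) r
  map_one' := rfl
  map_mul' _ _ := rfl
  map_zero' := rfl
  map_add' _ _ := rfl
  commutes' _ := rfl
  map_star' _ := rfl

/-- Any state would do; a vector state of one coordinate representation is at hand. On the matrix
algebras only its value at scalars will matter. -/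
lemma exists_state (hn : 0 < n) : ∃ φ : CuntzAlgebra n →ₗ[ℂ] ℂ,
    φ 1 = 1 ∧ (∀ a, 0 ≤ a → 0 ≤ φ a) ∧ ∀ a, ‖φ a‖ ≤ ‖a‖ := by
  obtain ⟨r⟩ := CuntzFamily.nonempty hn
  have h1 : ‖SeqHilbert.basis 0‖ = 1 := SeqHilbert.orthonormal_basis.1 0
  refine ⟨{ toFun := fun a => ⟪SeqHilbert.basis 0, eval r a (SeqHilbert.basis 0)⟫_ℂ
            map_add' := fun a b => by rw [map_add, add_apply, inner_add_right]
            map_smul' := fun c a => by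
              rw [map_smul, smul_apply, inner_smul_right]; rfl }, ?_, ?_, ?_⟩
  · simp [h1, inner_self_eq_norm_sq_to_K]
  · intro a ha
    have := ContinuousLinearMap.nonneg_iff_isPositive (eval r a) |>.1 (map_nonneg (eval r) ha)
    exact this.inner_nonneg_right _
  · intro a
    calc ‖⟪SeqHilbert.basis 0, eval r a (SeqHilbert.basis 0)⟫_ℂ‖
        ≤ ‖SeqHilbert.basis 0‖ * ‖eval r a (SeqHilbert.basis 0)‖ := norm_inner_le_norm _ _
      _ ≤ 1 * (‖a‖ * 1) := by
        rw [h1]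
        gcongr
        refine ((eval r a).le_opNorm _).trans ?_
        rw [h1]
        gcongr
        exact NonUnitalStarAlgHom.norm_apply_le (eval r) a
      _ = ‖a‖ := by ring

/-- The core has a tracial state that is faithful on the matrix subalgebras. -/
lemma exists_tracial_state (hn : 0 < n) : ∃ τ : core n →ₚ[ℂ] ℂ,
    τ 1 = 1 ∧ (∀ a b, τ (a * b) = τ (b * a)) ∧
      ∀ (k : ℕ) (a : core n), (a : CuntzAlgebra n) ∈ matrixAlg n k →
        τ (star a * a) = 0 → a = 0 := by
  obtain ⟨φ, hφ1, hφpos, hφle⟩ := exists_state hn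
  let U : Ultrafilter ℕ := Filter.hyperfilter ℕ
  have hbd : ∀ a, ∀ᶠ m in U, ‖φ ((average n ^ m) a)‖ ≤ ‖a‖ := fun a =>
    Eventually.of_forall fun m => (hφle _).trans (norm_average_pow_le hn.ne' m a)
  have ht := fun a => U.tendsto_limUnder_of_bounded (hbd a)
  -- The ultrafilter limit makes the functional defined, linear and bounded on all of `O_n` at once;
  -- on each matrix algebra the sequence is eventually constant and the limit is a genuine one.
  let ψ : CuntzAlgebra n →ₗ[ℂ] ℂ :=
    { toFun := fun a => limUnder U fun m => φ ((average n ^ m) a)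
      map_add' := fun a b => (((ht a).add (ht b)).congr fun m => by
        rw [map_add, map_add]).limUnder_eq
      map_smul' := fun c a => (((ht a).const_mul c).congr fun m => by
        rw [map_smul, map_smul, smul_eq_mul]).limUnder_eq }
  have hψle : ∀ a, ‖ψ a‖ ≤ 1 * ‖a‖ := fun a => by
    rw [one_mul]
    exact le_of_tendsto (ht a).norm (hbd a)
  have hψ : ∀ {k : ℕ} {a : CuntzAlgebra n}, a ∈ matrixAlg n k → ψ a = φ ((average n ^ k) a) := by
    intro k a ha
    refine (tendsto_const_nhds.congr' ?_).limUnder_eq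
    have h1 : ∀ᶠ m in U, k ≤ m :=
      (Nat.cofinite_eq_atTop ▸ Filter.hyperfilter_le_cofinite : (U : Filter ℕ) ≤ atTop)
        (eventually_ge_atTop k)
    filter_upwards [h1] with m hm
    rw [average_pow_eq_of_le hn.ne' hm ha]
  let ψc : CuntzAlgebra n →L[ℂ] ℂ := ψ.mkContinuous 1 hψle
  have hcomm : ∀ a ∈ core n, ∀ b ∈ core n, ψ (a * b) = ψ (b * a) := by
    have hc : ∀ k l, ∀ a ∈ matrixAlg n k, ∀ b ∈ matrixAlg n l, ψ (a * b) = ψ (b * a) := by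
      intro k l a ha b hb
      have ha' := matrixAlg_mono (le_max_left k l) ha
      have hb' := matrixAlg_mono (le_max_right k l) hb
      rw [hψ (mul_mem ha' hb'), hψ (mul_mem hb' ha'), average_pow_mul_comm ha' hb']
    have h1 : ∀ k, ∀ a ∈ matrixAlg n k, ∀ b ∈ core n, ψ (a * b) = ψ (b * a) := by
      intro k a ha b hb
      refine closure_minimal (t := {b | ψ (a * b) = ψ (b * a)}) ?_ ?_
        (core_subset_closure_iUnion_matrixAlg hb)
      · exact Set.iUnion_subset fun l b hb => hc k l a ha b hb
      · exact isClosed_eq (ψc.continuous.comp (continuous_const.mul continuous_id))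
          (ψc.continuous.comp (continuous_id.mul continuous_const))
    intro a ha b hb
    refine closure_minimal (t := {a | ψ (a * b) = ψ (b * a)}) ?_ ?_
        (core_subset_closure_iUnion_matrixAlg ha)
    · exact Set.iUnion_subset fun k a ha => h1 k a ha b hb
    · exact isClosed_eq (ψc.continuous.comp (continuous_id.mul continuous_const))
          (ψc.continuous.comp (continuous_const.mul continuous_id))
  refine ⟨PositiveLinearMap.mk₀ (ψ ∘ₗ (core n).toSubalgebra.toSubmodule.subtype)
    fun a ha => ?_, ?_, fun a b => hcomm a a.2 b b.2, fun k a hak ha => ?_⟩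
  · exact ge_of_tendsto (ht a) (Eventually.of_forall fun m =>
      hφpos _ (average_pow_nonneg m ha))
  · change ψ 1 = 1
    rw [hψ (one_mem (matrixAlg n 0)), pow_zero, Module.End.one_apply, hφ1]
  · replace ha : ψ (star (a : CuntzAlgebra n) * a) = 0 := ha
    have hmem := mul_mem (star_mem hak) hak
    obtain ⟨c, hc⟩ := mem_matrixAlg_zero.1 (average_pow_mem_matrixAlg hmem)
    rw [hψ hmem, ← hc, Algebra.algebraMap_eq_smul_one, map_smul, hφ1, smul_eq_mul, mul_one] at ha
    rw [ha, map_zero] at hc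
    exact Subtype.ext (eq_zero_of_average_pow_eq_zero hn.ne' k hc.symm)

end Average

end CuntzAlgebra

end

namespace CuntzAlgebra

/-! ### The Hilbert space of the gauge invariant state -/

section HilbertSpace

variable {n : ℕ} (τ : core n →ₚ[ℂ] ℂ)

lemma gaugeState_apply (a : CuntzAlgebra n) : gaugeState τ a = τ (expectation n a) := rfl

lemma norm_toL2_sq (a : CuntzAlgebra n) : ((‖toL2 τ a‖ ^ 2 : ℝ) : ℂ) = gaugeState τ (star a * a) := by
  rw [← inner_toL2, inner_self_eq_norm_sq_to_K]
  norm_cast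

lemma denseRange_toL2 : DenseRange (toL2 τ) :=
  (UniformSpace.Completion.denseRange_coe (α := (gaugeState τ).PreGNS)).comp
    (gaugeState τ).toPreGNS.surjective.denseRange (UniformSpace.Completion.continuous_coe _)

lemma leftMul_toL2_one (a : CuntzAlgebra n) : leftMul τ a (toL2 τ 1) = toL2 τ a := by
  rw [leftMul_toL2, mul_one]

lemma continuous_toL2 : Continuous (toL2 τ) := by
  refine AddMonoidHomClass.continuous_of_bound (toL2 τ) ‖toL2 τ 1‖ fun a => ?_
  rw [← leftMul_toL2_one, mul_comm]
  refine ((leftMul τ a).le_opNorm _).trans ?_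
  gcongr
  exact NonUnitalStarAlgHom.norm_apply_le (leftMul τ) a

lemma dense_toL2_algSpan : Dense (toL2 τ '' (algSpan n : Set (CuntzAlgebra n))) :=
  (denseRange_toL2 τ).dense_image (continuous_toL2 τ) dense_algSpan

lemma dense_span_monomial :
    Dense (Submodule.span ℂ {v | ∃ μ ν : List (Fin n), v = toL2 τ (monomial μ ν)} :
      Set (L2 τ)) := by
  refine (dense_toL2_algSpan τ).mono ?_
  rintro _ ⟨a, ha, rfl⟩
  have h : (algSpan n).map (toL2 τ) ≤
      Submodule.span ℂ {v | ∃ μ ν : List (Fin n), v = toL2 τ (monomial μ ν)} := by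
    rw [algSpan, Submodule.map_span, Submodule.span_le]
    rintro _ ⟨_, ⟨μ, ν, rfl⟩, rfl⟩
    exact Submodule.subset_span ⟨μ, ν, rfl⟩
  exact h ⟨a, ha, rfl⟩

variable {τ} in
lemma ext_toL2 {S T : L2 τ →L[ℂ] L2 τ} (h : ∀ a, S (toL2 τ a) = T (toL2 τ a)) : S = T :=
  DFunLike.coe_injective ((denseRange_toL2 τ).equalizer S.continuous T.continuous (funext h))

variable {τ} in
lemma ext_monomial {S T : L2 τ →L[ℂ] L2 τ}
    (h : ∀ μ ν, S (toL2 τ (monomial μ ν)) = T (toL2 τ (monomial μ ν))) : S = T :=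
  ContinuousLinearMap.ext_on (dense_span_monomial τ) (by rintro _ ⟨μ, ν, rfl⟩; exact h μ ν)

/-- The projection of `L²(O_n)` on the closure of `F`. -/
noncomputable abbrev coreProj : L2 τ →L[ℂ] L2 τ := (coreL2 τ).starProjection

lemma rankOneEnd_eq (x y : CuntzAlgebra n) :
    rankOneEnd τ x y = leftMul τ x * (coreProj τ * leftMul τ (star y)) := rfl

lemma coreProj_mul_self : coreProj τ * coreProj τ = coreProj τ :=
  (isStarProjection_starProjection (U := coreL2 τ)).isIdempotentElem

lemma star_coreProj : star (coreProj τ) = coreProj τ :=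
  (isSelfAdjoint_starProjection (coreL2 τ)).star_eq

lemma coreProj_toL2 (a : CuntzAlgebra n) : coreProj τ (toL2 τ a) = toL2 τ (gaugeMean a) :=
  starProjection_toL2 τ a

lemma coreProj_toL2_of_mem {f : CuntzAlgebra n} (hf : f ∈ core n) :
    coreProj τ (toL2 τ f) = toL2 τ f := by
  rw [coreProj_toL2, gaugeMean_of_mem hf]

lemma coreProj_mul_leftMul {f : CuntzAlgebra n} (hf : f ∈ core n) :
    coreProj τ * leftMul τ f = leftMul τ f * coreProj τ := by
  refine ext_toL2 fun a => ?_
  rw [mul_apply_eq_comp, mul_apply_eq_comp, leftMul_toL2, coreProj_toL2, coreProj_toL2,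
    leftMul_toL2, gaugeMean_mul hf]

/-- The basic construction relation: it reduces products of the `Θ_{x,y}` to the inner products
`Φ(y* x')`. -/
lemma coreProj_mul_leftMul_mul_coreProj (a : CuntzAlgebra n) :
    coreProj τ * leftMul τ a * coreProj τ = leftMul τ (gaugeMean a) * coreProj τ := by
  refine ext_toL2 fun b => ?_
  rw [mul_apply_eq_comp, mul_apply_eq_comp, mul_apply_eq_comp, coreProj_toL2, leftMul_toL2,
    leftMul_toL2, coreProj_toL2, gaugeMean_mul_right _ (gaugeMean_mem b)]

end HilbertSpace

/-! ### Right multiplication by elements of the core -/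

section RightMul

variable {n : ℕ} {τ : core n →ₚ[ℂ] ℂ}

/-- A gauge automorphism maps the positive square root of `c` to a positive square root of `c`;
uniqueness of the root makes it gauge invariant. -/
lemma exists_sqrt_mem_core {c : CuntzAlgebra n} (hc : c ∈ core n) (h0 : 0 ≤ c) :
    ∃ s ∈ core n, star s = s ∧ s * s = c := by
  refine ⟨CFC.sqrt c, fun z => ?_, (CFC.sqrt_nonneg c).isSelfAdjoint.star_eq,
    CFC.sqrt_mul_sqrt_self c h0⟩
  refine (CFC.sqrt_unique ?_ (map_nonneg (gauge z) (CFC.sqrt_nonneg c))).symm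
  rw [← map_mul, CFC.sqrt_mul_sqrt_self c h0, hc z]

/-- With `c = s²` and `s = s*`, traciality turns `τ(f* s s f)` into `τ(s f f* s)`, and `f f* ≤
‖f‖²`. -/
lemma trace_conj_le (htr : ∀ a b, τ (a * b) = τ (b * a)) (c : core n)
    (hc : 0 ≤ (c : CuntzAlgebra n)) (f : core n) :
    τ (star f * c * f) ≤ ((‖(f : CuntzAlgebra n)‖ ^ 2 : ℝ) : ℂ) * τ c := by
  obtain ⟨s, hs, hss, hsc⟩ := exists_sqrt_mem_core c.2 hc
  lift s to core n using hs
  obtain rfl : s * s = c := Subtype.ext hsc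
  have hss' : star s = s := Subtype.ext hss
  have h1 : star f * (s * s) * f = (star f * s) * (s * f) := by simp only [mul_assoc]
  have h2 : s * f * (star f * s) = star s * (f * star f) * s := by
    rw [hss']
    simp only [mul_assoc]
  have h4 : ((‖(f : CuntzAlgebra n)‖ ^ 2 : ℝ) : ℂ) * τ (s * s) =
      τ (((‖(f : CuntzAlgebra n)‖ ^ 2 : ℝ) : ℂ) • (s * s)) := by rw [map_smul, smul_eq_mul]
  rw [h1, htr, h2, h4]
  refine OrderHomClass.mono τ ?_
  have h3 := CStarAlgebra.star_left_conjugate_le_norm_smul (a := (s : CuntzAlgebra n))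
    (b := (f : CuntzAlgebra n) * star (f : CuntzAlgebra n)) (IsSelfAdjoint.mul_star_self _)
  rw [CStarRing.norm_self_mul_star, ← sq, hss, ← Complex.coe_smul] at h3
  change star (s : CuntzAlgebra n) * (f * star (f : CuntzAlgebra n)) * s ≤ _
  rw [hss]
  exact h3

/-- The bimodule property gives `Φ((a f)* (a f)) = f* Φ(a* a) f`, to which `trace_conj_le` applies.
-/
lemma norm_toL2_mul_le (htr : ∀ a b, τ (a * b) = τ (b * a)) (a : CuntzAlgebra n)
    {f : CuntzAlgebra n} (hf : f ∈ core n) : ‖toL2 τ (a * f)‖ ≤ ‖f‖ * ‖toL2 τ a‖ := by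
  lift f to core n using hf
  rw [← sq_le_sq₀ (norm_nonneg _) (by positivity), mul_pow, ← Complex.real_le_real,
    Complex.ofReal_mul, norm_toL2_sq, norm_toL2_sq]
  have h := trace_conj_le htr (expectation n (star a * a)) (gaugeMean_nonneg (star_mul_self_nonneg a)) f
  rw [gaugeState_apply, gaugeState_apply]
  convert h using 2
  rw [star_mul, mul_assoc, ← mul_assoc (star a)]
  have h1 := expectation_mul_left (star f) (star a * a * f)
  rw [expectation_mul_right] at h1
  rw [mul_assoc]
  exact h1

/-- Right multiplication by an element of the core is bounded on `L²(O_n)`. -/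
lemma exists_rightMul (htr : ∀ a b, τ (a * b) = τ (b * a)) {f : CuntzAlgebra n}
    (hf : f ∈ core n) : ∃ R : L2 τ →L[ℂ] L2 τ, ∀ a, R (toL2 τ a) = toL2 τ (a * f) := by
  let R₀ : (gaugeState τ).PreGNS →L[ℂ] (gaugeState τ).PreGNS :=
    ((gaugeState τ).toPreGNS.toLinearMap ∘ₗ LinearMap.mulRight ℂ f ∘ₗ
      (gaugeState τ).ofPreGNS.toLinearMap).mkContinuous ‖f‖ fun x => by
        have h := norm_toL2_mul_le htr ((gaugeState τ).ofPreGNS x) hf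
        have hn : ∀ b, ‖toL2 τ b‖ = ‖(gaugeState τ).toPreGNS b‖ := fun b =>
          UniformSpace.Completion.norm_coe _
        rw [hn, hn] at h
        exact h
  exact ⟨R₀.completion, fun a => R₀.completion_apply_coe _⟩

/-- `R` is right multiplication by `f`. -/
def IsRightMul (f : CuntzAlgebra n) (R : L2 τ →L[ℂ] L2 τ) : Prop :=
  ∀ a, R (toL2 τ a) = toL2 τ (a * f)

lemma IsRightMul.leftMul_comm {f : CuntzAlgebra n} {R : L2 τ →L[ℂ] L2 τ} (hR : IsRightMul f R)
    (x : CuntzAlgebra n) : leftMul τ x * R = R * leftMul τ x := by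
  refine ext_toL2 fun a => ?_
  rw [mul_apply_eq_comp, mul_apply_eq_comp, leftMul_toL2, hR, hR, leftMul_toL2, mul_assoc]

lemma IsRightMul.coreProj_comm {f : CuntzAlgebra n} {R : L2 τ →L[ℂ] L2 τ} (hR : IsRightMul f R)
    (hf : f ∈ core n) : coreProj τ * R = R * coreProj τ := by
  refine ext_toL2 fun a => ?_
  rw [mul_apply_eq_comp, mul_apply_eq_comp, coreProj_toL2, hR, hR, coreProj_toL2,
    gaugeMean_mul_right _ hf]

lemma finiteRankEnd_subset_endVN {T : L2 τ →L[ℂ] L2 τ} (hT : T ∈ finiteRankEnd τ) :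
    T ∈ endVN τ :=
  Set.subset_centralizer_centralizer hT

lemma rankOneEnd_mem_endVN {x y : CuntzAlgebra n} (hx : x ∈ algSpan n) (hy : y ∈ algSpan n) :
    rankOneEnd τ x y ∈ endVN τ :=
  finiteRankEnd_subset_endVN (Submodule.subset_span ⟨x, hx, y, hy, rfl⟩)

/-- Right multiplication by `f` commutes with left multiplications and with the projection on the
closure of `F`, hence with every `Θ_{x,y}`, and so with their double commutant. -/
lemma IsRightMul.comm {f : CuntzAlgebra n} {R : L2 τ →L[ℂ] L2 τ} (hR : IsRightMul f R)
    (hf : f ∈ core n) {T : L2 τ →L[ℂ] L2 τ} (hT : T ∈ endVN τ) : R * T = T * R := by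
  have h : R ∈ (finiteRankEnd τ : Set (L2 τ →L[ℂ] L2 τ)).centralizer := by
    intro S hS
    induction hS using Submodule.span_induction with
    | mem S hS =>
      obtain ⟨x, -, y, -, rfl⟩ := hS
      rw [rankOneEnd_eq, mul_assoc, mul_assoc, hR.leftMul_comm, ← mul_assoc (coreProj τ),
        hR.coreProj_comm hf, mul_assoc, ← mul_assoc, hR.leftMul_comm, mul_assoc]
    | zero => rw [zero_mul, mul_zero]
    | add S S' _ _ h h' => rw [add_mul, mul_add, h, h']
    | smul c S _ h => rw [smul_mul_assoc, mul_smul_comm, h]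
  exact hT R h

end RightMul

/-! ### Faithfulness of the trace on the core -/

section Faithful

variable {n : ℕ} {τ : core n →ₚ[ℂ] ℂ}

lemma toL2_eq_zero_iff (f : core n) : toL2 τ (f : CuntzAlgebra n) = 0 ↔ τ (star f * f) = 0 := by
  have h := norm_toL2_sq τ (f : CuntzAlgebra n)
  have h1 : expectation n (star (f : CuntzAlgebra n) * f) = star f * f := expectation_coe (star f * f)
  rw [gaugeState_apply, h1] at h
  rw [← h, ← norm_eq_zero]
  norm_cast
  rw [sq_eq_zero_iff]

/-- The representation of `F` on the closure of `F` in `L²(O_n)`, extended by zero. -/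
noncomputable def coreRep (τ : core n →ₚ[ℂ] ℂ) : core n →⋆ₙₐ[ℂ] (L2 τ →L[ℂ] L2 τ) where
  toFun f := leftMul τ f * coreProj τ
  map_smul' c f := by
    change leftMul τ (c • (f : CuntzAlgebra n)) * _ = _
    rw [map_smul, smul_mul_assoc]
    rfl
  map_zero' := by
    change leftMul τ (0 : CuntzAlgebra n) * _ = _
    rw [map_zero, zero_mul]
  map_add' f g := by
    change leftMul τ ((f : CuntzAlgebra n) + g) * _ = _
    rw [map_add, add_mul]
  map_mul' f g := by
    change leftMul τ ((f : CuntzAlgebra n) * g) * _ = _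
    rw [map_mul, mul_assoc, mul_assoc, ← mul_assoc (coreProj τ), coreProj_mul_leftMul τ g.2,
      mul_assoc, coreProj_mul_self]
  map_star' f := by
    change leftMul τ (star (f : CuntzAlgebra n)) * _ = _
    rw [star_mul, star_coreProj, ← map_star, coreProj_mul_leftMul τ (star_mem f.2)]

lemma coreRep_apply (f : core n) : coreRep τ f = leftMul τ f * coreProj τ := rfl

lemma coreRep_toL2_one (f : core n) : coreRep τ f (toL2 τ 1) = toL2 τ (f : CuntzAlgebra n) := by
  rw [coreRep_apply, mul_apply_eq_comp, coreProj_toL2_of_mem τ (one_mem _), leftMul_toL2_one]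

/-- An injective star homomorphism of C⋆-algebras is isometric, and injectivity follows by
evaluating at the vector `1`. -/
lemma norm_coreRep_of_mem_matrixAlg {k : ℕ}
    (h : ∀ a : core n, (a : CuntzAlgebra n) ∈ matrixAlg n k → τ (star a * a) = 0 → a = 0)
    {a : CuntzAlgebra n} (ha : a ∈ matrixAlg n k) :
    ‖coreRep τ ⟨a, matrixAlg_le_core k ha⟩‖ = ‖a‖ := by
  have : IsClosed (matrixAlg n k : Set (CuntzAlgebra n)) := isClosed_matrixAlg k
  let ρ : matrixAlg n k →⋆ₙₐ[ℂ] (L2 τ →L[ℂ] L2 τ) :=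
    (coreRep τ).comp (StarSubalgebra.inclusion (matrixAlg_le_core k) :
      matrixAlg n k →⋆ₐ[ℂ] core n).toNonUnitalStarAlgHom
  suffices h0 : ∀ b, ρ b = 0 → b = 0 from
    NonUnitalStarAlgHom.norm_map ρ ((injective_iff_map_eq_zero ρ).2 h0) ⟨a, ha⟩
  intro b hb
  have hb' : coreRep τ ⟨b, matrixAlg_le_core k b.2⟩ (toL2 τ 1) = 0 := by
    rw [show coreRep τ ⟨b, matrixAlg_le_core k b.2⟩ = 0 from hb]
    rfl
  rw [coreRep_toL2_one, toL2_eq_zero_iff] at hb'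
  have h1 := h ⟨b, matrixAlg_le_core k b.2⟩ b.2 hb'
  exact Subtype.ext (congrArg (fun x : core n => (x : CuntzAlgebra n)) h1)

lemma norm_coreRep
    (h : ∀ (k : ℕ) (a : core n), (a : CuntzAlgebra n) ∈ matrixAlg n k →
      τ (star a * a) = 0 → a = 0) (a : core n) :
    ‖leftMul τ a * coreProj τ‖ = ‖(a : CuntzAlgebra n)‖ := by
  have hc : Continuous (leftMul τ) := AddMonoidHomClass.continuous_of_bound (leftMul τ) 1
    fun a => by simpa using NonUnitalStarAlgHom.norm_apply_le (leftMul τ) a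
  refine closure_minimal (t := {a | ‖leftMul τ a * coreProj τ‖ = ‖a‖}) ?_ ?_
    (core_subset_closure_iUnion_matrixAlg a.2)
  · exact Set.iUnion_subset fun k a ha => norm_coreRep_of_mem_matrixAlg (h k) ha
  · exact isClosed_eq (hc.mul continuous_const).norm continuous_norm

/-- A tracial state on the core that is faithful on the matrix subalgebras is faithful. -/
lemma faithful_of_matrixAlg (htr : ∀ a b, τ (a * b) = τ (b * a))
    (h : ∀ (k : ℕ) (a : core n), (a : CuntzAlgebra n) ∈ matrixAlg n k →
      τ (star a * a) = 0 → a = 0) (a : core n) (ha : τ (star a * a) = 0) : a = 0 := by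
  -- Boundedness of right multiplication propagates `a · 1 = 0` in `L²` to `a b = 0` for every `b`
  -- in `F`.
  have h0 : leftMul τ (a : CuntzAlgebra n) * coreProj τ = 0 := by
    refine ext_toL2 fun b => ?_
    rw [mul_apply_eq_comp, coreProj_toL2, leftMul_toL2, zero_apply, ← norm_le_zero_iff]
    refine (norm_toL2_mul_le htr _ (gaugeMean_mem b)).trans_eq ?_
    rw [(toL2_eq_zero_iff a).2 ha, norm_zero, mul_zero]
  have h1 := norm_coreRep h a
  rw [h0, norm_zero] at h1
  exact Subtype.ext (norm_eq_zero.1 h1.symm)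

theorem exists_isFaithfulNormalizedTrace (hn : 0 < n) :
    ∃ τ : core n →ₚ[ℂ] ℂ, IsFaithfulNormalizedTrace τ := by
  obtain ⟨τ, h1, htr, hf⟩ := exists_tracial_state hn
  exact ⟨τ, h1, htr, faithful_of_matrixAlg htr hf⟩

end Faithful

/-! ### Uniqueness of the trace on the core -/

section Unique

variable {n : ℕ}

/-- Write `S_μ S_ν*` as `(S_μ S_ν*)(S_ν S_ν*)`; after exchanging the factors, the product contains
`S_ν* S_μ = 0`. -/
lemma IsFaithfulNormalizedTrace.apply_monomial_ne {τ : core n →ₚ[ℂ] ℂ}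
    (hτ : IsFaithfulNormalizedTrace τ) {μ ν : List (Fin n)} (hl : μ.length = ν.length)
    (h : μ ≠ ν) : τ ⟨monomial μ ν, monomial_mem_core hl⟩ = 0 := by
  have h1 : (⟨monomial μ ν, monomial_mem_core hl⟩ : core n) =
      ⟨monomial μ ν, monomial_mem_core hl⟩ * ⟨monomial ν ν, monomial_mem_core rfl⟩ := by
    refine Subtype.ext ?_
    change monomial μ ν = monomial μ ν * monomial ν ν
    rw [monomial_eq, monomial_eq, mul_assoc, ← mul_assoc (star (word ν)), star_word_mul_word,
      one_mul]
  have h2 : (⟨monomial ν ν, monomial_mem_core rfl⟩ * ⟨monomial μ ν, monomial_mem_core hl⟩ : core n)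
      = 0 := by
    refine Subtype.ext ?_
    change monomial ν ν * monomial μ ν = 0
    rw [monomial_eq, monomial_eq, mul_assoc, ← mul_assoc (star (word ν)),
      star_word_mul_word_of_ne hl.symm h.symm, zero_mul, mul_zero]
  rw [h1, hτ.map_mul_comm, h2, map_zero]

/-- The two range projections are `v v*` and `v* v` for `v = S_μ S_ν*`. -/
lemma IsFaithfulNormalizedTrace.apply_monomial_self_congr {τ : core n →ₚ[ℂ] ℂ}
    (hτ : IsFaithfulNormalizedTrace τ) {μ ν : List (Fin n)} (hl : μ.length = ν.length) :
    τ ⟨monomial μ μ, monomial_mem_core rfl⟩ = τ ⟨monomial ν ν, monomial_mem_core rfl⟩ := by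
  have h1 : ∀ {μ ν : List (Fin n)} (hl : μ.length = ν.length),
      (⟨monomial μ μ, monomial_mem_core rfl⟩ : core n) =
      ⟨monomial μ ν, monomial_mem_core hl⟩ * ⟨monomial ν μ, monomial_mem_core hl.symm⟩ := by
    intro μ ν hl
    refine Subtype.ext ?_
    change monomial μ μ = monomial μ ν * monomial ν μ
    rw [monomial_eq, monomial_eq, monomial_eq, mul_assoc, ← mul_assoc (star (word ν)),
      star_word_mul_word, one_mul]
  rw [h1 hl, hτ.map_mul_comm, ← h1 hl.symm]

lemma IsFaithfulNormalizedTrace.apply_monomial_self (hn : n ≠ 0) {τ : core n →ₚ[ℂ] ℂ}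
    (hτ : IsFaithfulNormalizedTrace τ) (μ : List (Fin n)) :
    τ ⟨monomial μ μ, monomial_mem_core rfl⟩ = ((n : ℂ) ^ μ.length)⁻¹ := by
  induction μ with
  | nil =>
    have : (⟨monomial [] [], monomial_mem_core rfl⟩ : core n) = 1 :=
      Subtype.ext (by simp [monomial_eq])
    rw [this, hτ.map_one]
    simp
  | cons i μ ih =>
    -- The range projection of `S_μ` splits into those of its `n` one-letter extensions, which all
    -- have the same trace as that of `i :: μ`.
    have h1 : (⟨monomial μ μ, monomial_mem_core rfl⟩ : core n) =
        ∑ j : Fin n, ⟨monomial (μ ++ [j]) (μ ++ [j]), monomial_mem_core rfl⟩ := by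
      refine Subtype.ext ?_
      rw [AddSubmonoidClass.coe_finsetSum]
      have h2 : ∀ j : Fin n, monomial (μ ++ [j]) (μ ++ [j]) =
          word μ * (gen j * star (gen j)) * star (word μ : CuntzAlgebra n) := fun j => by
        simp only [monomial_eq, word_append, word_cons, word_nil, mul_one, star_mul, mul_assoc]
      simp only [h2, ← Finset.sum_mul, ← Finset.mul_sum, sum_gen_mul_star, mul_one, monomial_eq]
    rw [h1, map_sum, Finset.sum_congr rfl fun j _ => hτ.apply_monomial_self_congr
      (show (μ ++ [j]).length = (i :: μ).length by simp)] at ih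
    rw [Finset.sum_const, Finset.card_univ, Fintype.card_fin, nsmul_eq_mul] at ih
    have hn' : (n : ℂ) ≠ 0 := Nat.cast_ne_zero.2 hn
    have hl : ((n : ℂ) ^ (i :: μ).length)⁻¹ = ((n : ℂ) ^ μ.length)⁻¹ * (n : ℂ)⁻¹ := by
      rw [List.length_cons, pow_succ, mul_inv]
    rw [hl, ← ih]
    field_simp

/-- Cauchy–Schwarz for `τ a = ⟨1, a · 1⟩`, where the vector `1` is a unit vector. -/
lemma norm_apply_le_of_map_one {τ : core n →ₚ[ℂ] ℂ} (h1 : τ 1 = 1) (a : core n) :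
    ‖τ a‖ ^ 2 ≤ ‖(a : CuntzAlgebra n)‖ ^ 2 := by
  have h2 : ⟪toL2 τ 1, toL2 τ (a : CuntzAlgebra n)⟫_ℂ = τ a := by
    rw [inner_toL2, star_one, one_mul, gaugeState_apply, expectation_coe]
  have h3 : ‖toL2 τ 1‖ = 1 := by
    have h := norm_toL2_sq τ 1
    have h4 : expectation n (1 : CuntzAlgebra n) = 1 := expectation_coe 1
    rw [star_one, one_mul, gaugeState_apply, h4, h1] at h
    have h5 : ‖toL2 τ 1‖ ^ 2 = 1 := by exact_mod_cast h
    exact (pow_eq_one_iff_of_nonneg (norm_nonneg _) two_ne_zero).1 h5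
  gcongr
  rw [← h2]
  refine (norm_inner_le_norm _ _).trans ?_
  rw [h3, one_mul, ← leftMul_toL2_one]
  refine ((leftMul τ (a : CuntzAlgebra n)).le_opNorm _).trans ?_
  rw [h3, mul_one]
  exact NonUnitalStarAlgHom.norm_apply_le (leftMul τ) _

theorem IsFaithfulNormalizedTrace.unique (hn : n ≠ 0) {τ τ' : core n →ₚ[ℂ] ℂ}
    (hτ : IsFaithfulNormalizedTrace τ) (hτ' : IsFaithfulNormalizedTrace τ') : τ' = τ := by
  have hcont : ∀ {σ : core n →ₚ[ℂ] ℂ}, IsFaithfulNormalizedTrace σ →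
      Continuous fun a : CuntzAlgebra n => gaugeState σ a := by
    intro σ hσ
    refine AddMonoidHomClass.continuous_of_bound (gaugeState σ) 1 fun a => ?_
    rw [one_mul]
    exact (abs_le_of_sq_le_sq' (norm_apply_le_of_map_one hσ.map_one _) (norm_nonneg _)).2.trans
      (norm_gaugeMean_le a)
  have hspan : ∀ a ∈ coreSpan n, gaugeState τ' a = gaugeState τ a := by
    intro a ha
    induction ha using Submodule.span_induction with
    | mem a ha =>
      obtain ⟨μ, ν, hl, rfl⟩ := ha
      have h1 : expectation n (monomial μ ν) = ⟨monomial μ ν, monomial_mem_core hl⟩ :=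
        expectation_coe (⟨monomial μ ν, monomial_mem_core hl⟩ : core n)
      rw [gaugeState_apply, gaugeState_apply, h1]
      by_cases h : μ = ν
      · subst h
        rw [hτ.apply_monomial_self hn, hτ'.apply_monomial_self hn]
      · rw [hτ.apply_monomial_ne hl h, hτ'.apply_monomial_ne hl h]
    | zero => rw [map_zero, map_zero]
    | add a b _ _ ha hb => rw [map_add, map_add, ha, hb]
    | smul c a _ ha => rw [map_smul, map_smul, ha]
  refine PositiveLinearMap.ext fun a => ?_
  have h := closure_minimal (t := {a | gaugeState τ' a = gaugeState τ a}) hspan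
    (isClosed_eq (hcont hτ') (hcont hτ)) (core_subset_closure_coreSpan a.2)
  rw [Set.mem_ofPred_eq, gaugeState_apply, gaugeState_apply, expectation_coe] at h
  exact h

end Unique

end CuntzAlgebra

section

open Filter Topology

/-! ### Strongly convergent sums of orthogonal projections -/

section OrthogonalProjections

variable {H : Type*} [NormedAddCommGroup H] [InnerProductSpace ℂ H] [CompleteSpace H] {ι : Type*}

lemma isStarProjection_sum {q : ι → H →L[ℂ] H} (hq : ∀ i, IsStarProjection (q i))
    (hort : ∀ i j, i ≠ j → q i * q j = 0) (s : Finset ι) : IsStarProjection (∑ i ∈ s, q i) where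
  isIdempotentElem := by
    classical
    rw [IsIdempotentElem, Finset.sum_mul_sum]
    refine Finset.sum_congr rfl fun i hi => ?_
    rw [Finset.sum_eq_single i (fun j _ hj => hort i j hj.symm) (fun h => absurd hi h),
      (hq i).isIdempotentElem]
  isSelfAdjoint := isSelfAdjoint_sum _ fun i _ => (hq i).isSelfAdjoint

/-- Pairwise orthogonal projections whose ranges span a dense subspace sum up to the identity. -/
theorem hasSum_projections {q : ι → H →L[ℂ] H} (hq : ∀ i, IsStarProjection (q i))
    (hort : ∀ i j, i ≠ j → q i * q j = 0) {M : Set H} (hM : Dense (Submodule.span ℂ M : Set H))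
    (hfix : ∀ v ∈ M, ∃ i, q i v = v) (v : H) : HasSum (fun i => q i v) v := by
  have hspan : ∀ w ∈ Submodule.span ℂ M, HasSum (fun i => q i w) w := by
    intro w hw
    induction hw using Submodule.span_induction with
    | mem w hw =>
      obtain ⟨i, hi⟩ := hfix w hw
      convert hasSum_single i fun j hj => ?_ using 1
      · exact hi.symm
      · rw [← hi, ← mul_apply_eq_comp, hort j i hj]
        rfl
    | zero => simp
    | add w w' _ _ h h' => simpa using h.add h'
    | smul c w _ h => simpa using h.const_smul c
  rw [HasSum, SummationFilter.unconditional_filter, Metric.tendsto_nhds]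
  intro ε hε
  obtain ⟨w, hw, hvw⟩ := Metric.mem_closure_iff.1 (hM v) (ε / 3) (by positivity)
  have hw' := hspan w hw
  rw [HasSum, SummationFilter.unconditional_filter, Metric.tendsto_nhds] at hw'
  filter_upwards [hw' (ε / 3) (by positivity)] with s hs
  -- Finite partial sums are projections, hence contractions: the approximation error is controlled
  -- uniformly in `s`.
  have h1 : dist (∑ i ∈ s, q i v) (∑ i ∈ s, q i w) ≤ dist v w := by
    rw [dist_eq_norm, dist_eq_norm, ← sum_apply, ← sum_apply, ← map_sub]
    refine ((∑ i ∈ s, q i).le_opNorm _).trans (mul_le_of_le_one_left (norm_nonneg _) ?_)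
    exact (isStarProjection_sum hq hort s).norm_le
  calc dist (∑ i ∈ s, q i v) v
      ≤ dist (∑ i ∈ s, q i v) (∑ i ∈ s, q i w) + dist (∑ i ∈ s, q i w) w + dist w v :=
        dist_triangle4 _ _ _ _
    _ < ε := by rw [dist_comm w v]; linarith

end OrthogonalProjections

/-! ### Weights given by a family of vectors -/

section VectorWeight

variable {H : Type*} [NormedAddCommGroup H] [InnerProductSpace ℂ H] {ι : Type*}

/-- The weight `T ↦ ∑ ⟨T ξᵢ, ξᵢ⟩` on positive operators. -/
noncomputable def vectorWeight (ξ : ι → H) (T : H →L[ℂ] H) : ℝ≥0∞ :=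
  ∑' i, ENNReal.ofReal (⟪T (ξ i), ξ i⟫_ℂ).re

variable (ξ : ι → H)

lemma ContinuousLinearMap.re_inner_apply_nonneg {T : H →L[ℂ] H} (hT : 0 ≤ T) (v : H) :
    0 ≤ (⟪T v, v⟫_ℂ).re :=
  ((ContinuousLinearMap.nonneg_iff_isPositive T).1 hT).re_inner_nonneg_left v

lemma vectorWeight_add {S T : H →L[ℂ] H} (hS : 0 ≤ S) (hT : 0 ≤ T) :
    vectorWeight ξ (S + T) = vectorWeight ξ S + vectorWeight ξ T := by
  rw [vectorWeight, vectorWeight, vectorWeight, ← ENNReal.tsum_add]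
  refine tsum_congr fun i => ?_
  rw [add_apply, inner_add_left, Complex.add_re,
    ENNReal.ofReal_add (ContinuousLinearMap.re_inner_apply_nonneg hS _)
      (ContinuousLinearMap.re_inner_apply_nonneg hT _)]

lemma vectorWeight_smul (c : ℝ≥0) (T : H →L[ℂ] H) :
    vectorWeight ξ ((c : ℂ) • T) = c * vectorWeight ξ T := by
  rw [vectorWeight, vectorWeight, ← ENNReal.tsum_mul_left]
  refine tsum_congr fun i => ?_
  have h : (⟪((c : ℂ) • T) (ξ i), ξ i⟫_ℂ).re = (c : ℝ) * (⟪T (ξ i), ξ i⟫_ℂ).re := by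
    rw [smul_apply, inner_smul_left]
    simp
  rw [h, ENNReal.ofReal_mul c.coe_nonneg, ENNReal.ofReal_coe_nnreal]

lemma vectorWeight_mono {S T : H →L[ℂ] H} (h : S ≤ T) : vectorWeight ξ S ≤ vectorWeight ξ T :=
  ENNReal.tsum_le_tsum fun i => ENNReal.ofReal_le_ofReal
    (ContinuousLinearMap.inner_apply_le h (ξ i)).1

lemma hasSum_inner_of_vectorWeight_lt_top {T : H →L[ℂ] H} (hT : 0 ≤ T)
    (h : vectorWeight ξ T < ∞) :
    HasSum (fun i => ⟪ξ i, T (ξ i)⟫_ℂ) ((vectorWeight ξ T).toReal : ℂ) := by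
  have hpos := (ContinuousLinearMap.nonneg_iff_isPositive T).1 hT
  have h1 : ∀ i, ⟪ξ i, T (ξ i)⟫_ℂ =
      (((ENNReal.ofReal (⟪T (ξ i), ξ i⟫_ℂ).re).toReal : ℝ) : ℂ) := fun i => by
    rw [ENNReal.toReal_ofReal (ContinuousLinearMap.re_inner_apply_nonneg hT _), ← hpos.inner_left_eq_inner_right]
    exact Complex.ext rfl (Complex.nonneg_iff.1 (hpos.inner_nonneg_left _)).2.symm
  simp only [h1]
  refine Complex.hasSum_ofReal.2 ?_
  rw [vectorWeight, ENNReal.tsum_toReal_eq fun i => ENNReal.ofReal_ne_top]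
  exact (ENNReal.hasSum_toReal h.ne).summable.hasSum

lemma vectorWeight_lt_top_of_summable {T : H →L[ℂ] H} (hT : 0 ≤ T)
    (h : Summable fun i => ⟪ξ i, T (ξ i)⟫_ℂ) : vectorWeight ξ T < ∞ := by
  have hpos := (ContinuousLinearMap.nonneg_iff_isPositive T).1 hT
  have h1 : Summable fun i => (⟪T (ξ i), ξ i⟫_ℂ).re := by
    simp only [hpos.inner_left_eq_inner_right]
    exact (Complex.hasSum_re h.hasSum).summable
  rw [vectorWeight, ← ENNReal.ofReal_tsum_of_nonneg (fun i =>
    ContinuousLinearMap.re_inner_apply_nonneg hT _) h1]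
  exact ENNReal.ofReal_lt_top

variable [CompleteSpace H]

lemma vectorWeight_star_mul_self (T : H →L[ℂ] H) :
    vectorWeight ξ (star T * T) = ∑' i, ENNReal.ofReal (‖T (ξ i)‖ ^ 2) := by
  refine tsum_congr fun i => ?_
  rw [mul_apply_eq_comp, ContinuousLinearMap.star_eq_adjoint,
    ContinuousLinearMap.adjoint_inner_left, inner_self_eq_norm_sq_to_K]
  norm_cast

/-- Each `⟨T ξᵢ, ξᵢ⟩` is the squared norm of `T^{1/2} ξᵢ`, so `T^{1/2}` kills `ξᵢ`, and then so does
`T`. -/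
lemma apply_eq_zero_of_vectorWeight_eq_zero {T : H →L[ℂ] H} (hT : 0 ≤ T)
    (h : vectorWeight ξ T = 0) (i : ι) : T (ξ i) = 0 := by
  have hs : CFC.sqrt T * CFC.sqrt T = T := CFC.sqrt_mul_sqrt_self T hT
  have hs' : star (CFC.sqrt T) = CFC.sqrt T := (CFC.sqrt_nonneg T).isSelfAdjoint.star_eq
  have h1 : vectorWeight ξ (star (CFC.sqrt T) * CFC.sqrt T) = 0 := by rw [hs', hs, h]
  rw [vectorWeight_star_mul_self] at h1
  have h2 := ENNReal.ofReal_eq_zero.1 (ENNReal.tsum_eq_zero.1 h1 i)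
  have h3 : CFC.sqrt T (ξ i) = 0 := by
    rw [← norm_eq_zero]
    nlinarith [norm_nonneg (CFC.sqrt T (ξ i))]
  rw [← hs, mul_apply_eq_comp, h3, map_zero]

lemma vectorWeight_eq_iSup {s : Set (H →L[ℂ] H)} {T : H →L[ℂ] H} (hne : s.Nonempty)
    (hdir : DirectedOn (· ≤ ·) s) (hpos : ∀ S ∈ s, 0 ≤ S) (hT : IsLUB s T) :
    vectorWeight ξ T = ⨆ S ∈ s, vectorWeight ξ S := by
  refine le_antisymm ?_ (iSup₂_le fun S hS => vectorWeight_mono ξ (hT.1 hS))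
  rw [vectorWeight]
  simp only [ofReal_inner_eq_iSup hne hdir hpos hT]
  rw [ENNReal.tsum_eq_iSup_sum]
  refine iSup_le fun F => ?_
  simp only [iSup_subtype']
  -- For a finite partial sum the supremum passes through the sum because the net is directed and
  -- each term is monotone.
  rw [ENNReal.finsetSum_iSup]
  · exact iSup_mono fun S => ENNReal.sum_le_tsum F
  · intro S S'
    obtain ⟨S'', hS'', h, h'⟩ := hdir S S.2 S' S'.2
    exact ⟨⟨S'', hS''⟩, fun i => ⟨ENNReal.ofReal_le_ofReal
      (ContinuousLinearMap.inner_apply_le h (ξ i)).1, ENNReal.ofReal_le_ofReal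
      (ContinuousLinearMap.inner_apply_le h' (ξ i)).1⟩⟩

end VectorWeight

/-! ### Square roots, linear extension of weights and finite projections -/

namespace VonNeumannAlgebra

variable {H : Type*} [NormedAddCommGroup H] [InnerProductSpace ℂ H] [CompleteSpace H]
  {N : VonNeumannAlgebra H}

lemma sqrt_mem {T : H →L[ℂ] H} (hT : T ∈ N) : CFC.sqrt T ∈ N := by
  rw [← N.commutant_commutant, mem_commutant_iff]
  intro u hu
  have h : Commute T u := mem_commutant_iff.1 hu T hT
  exact (Commute.cfcₙ_nnreal h NNReal.sqrt).symm

/-- The linear extension of a weight given by a family of vectors. -/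
lemma exists_linear_extension {ι : Type*} (N : VonNeumannAlgebra H) (ξ : ι → H) :
    ∃ t : N.traceDomain (vectorWeight ξ) →ₗ[ℂ] ℂ,
      ∀ T : N.traceDomain (vectorWeight ξ), HasSum (fun i => ⟪ξ i, (T : H →L[ℂ] H) (ξ i)⟫_ℂ) (t T) := by
  have hs : ∀ T ∈ N.traceDomain (vectorWeight ξ), Summable fun i => ⟪ξ i, T (ξ i)⟫_ℂ := by
    intro T hT
    -- Summability is the only thing to check on the span: the series is visibly linear in `T`, so
    -- the extension does not depend on a decomposition into positive elements.
    induction hT using Submodule.span_induction with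
    | mem T hT => exact (hasSum_inner_of_vectorWeight_lt_top ξ hT.2.1 hT.2.2).summable
    | zero => simp
    | add S T _ _ hS hT => simpa [inner_add_right] using hS.add hT
    | smul c T _ hT => simpa [inner_smul_right] using hT.mul_left c
  exact ⟨{
    toFun := fun T : N.traceDomain (vectorWeight ξ) => ∑' i, ⟪ξ i, (T : H →L[ℂ] H) (ξ i)⟫_ℂ
    map_add' := fun S T => by
      rw [← (hs S S.2).tsum_add (hs T T.2)]
      simp
    map_smul' := fun c T => by
      rw [RingHom.id_apply, smul_eq_mul, ← tsum_mul_left]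
      simp }, fun T => (hs T T.2).hasSum⟩

/-- A projection majorized by a projection of finite trace is finite. -/
lemma IsFNSTrace.isFiniteProjection {τ : (H →L[ℂ] H) → ℝ≥0∞} (hτ : N.IsFNSTrace τ)
    {p : H →L[ℂ] H} (hp : p ∈ N) (hproj : IsStarProjection p) (hfin : τ p < ∞) :
    N.IsFiniteProjection p := by
  refine ⟨hp, hproj, fun v hv hvp hle => ?_⟩
  have h1 : v * star v ∈ N := mul_mem hv (star_mem hv)
  have h2 : p - v * star v ∈ N := sub_mem hp h1
  have h3 : τ (v * star v) = τ p := by rw [← hτ.tracial v hv, hvp]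
  have h4 := hτ.map_add _ h1 _ h2 (mul_star_self_nonneg v) (sub_nonneg.2 hle)
  rw [add_sub_cancel, h3] at h4
  have h5 : τ (p - v * star v) = 0 := by
    have : τ p + τ (p - v * star v) = τ p + 0 := by rw [← h4, add_zero]
    exact (ENNReal.add_right_inj hfin.ne).1 this
  exact (sub_eq_zero.1 (hτ.faithful _ h2 (sub_nonneg.2 hle) h5)).symm

end VonNeumannAlgebra

end

namespace CuntzAlgebra

/-! ### A frame of the module `X_c` -/

section Frame

variable {n : ℕ} (i₀ : Fin n)

/-- The frame of `X_c` over `F` formed by the `S_μ` for all words `μ` and by the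
`(S_{i₀}*)^k` for `k ≥ 1`. -/
noncomputable def frame : List (Fin n) ⊕ ℕ → CuntzAlgebra n
  | .inl μ => word μ
  -- The exponent is `k + 1`, since the power zero is already present as the empty word.
  | .inr k => star (word (List.replicate (k + 1) i₀))

/-- The degree of the elements of the frame. -/
def frameDegree : List (Fin n) ⊕ ℕ → ℤ
  | .inl μ => μ.length
  | .inr k => -(k + 1)

lemma frame_mem_algSpan (i : List (Fin n) ⊕ ℕ) : frame i₀ i ∈ algSpan n := by
  cases i with
  | inl μ => exact word_mem_algSpan μ
  | inr k => exact star_word_mem_algSpan _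

lemma isHomogeneous_frame (i : List (Fin n) ⊕ ℕ) :
    IsHomogeneous (frameDegree i) (frame i₀ i) := by
  cases i with
  | inl μ => exact isHomogeneous_word μ
  | inr k =>
    have := (isHomogeneous_word (List.replicate (k + 1) i₀)).star
    rw [List.length_replicate, Nat.cast_succ] at this
    exact this

/-- The frame consists of isometries and coisometries; being partial isometries is what makes the
`Θ_{ξ,ξ}` idempotent. -/
lemma frame_mul_star_mul_frame (i : List (Fin n) ⊕ ℕ) :
    frame i₀ i * (star (frame i₀ i) * frame i₀ i) = frame i₀ i := by
  cases i with
  | inl μ => rw [frame, star_word_mul_word, mul_one]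
  | inr k => rw [frame, star_star, ← mul_assoc, star_word_mul_word, one_mul]

lemma star_frame_mul_frame_mem (i : List (Fin n) ⊕ ℕ) :
    star (frame i₀ i) * frame i₀ i ∈ core n := by
  have := (isHomogeneous_frame i₀ i).star.mul (isHomogeneous_frame i₀ i)
  rwa [neg_add_cancel, isHomogeneous_zero_iff] at this

/-- Different degrees are killed by averaging. In equal degrees only distinct words of the same
length can occur, since each negative degree has a single frame element, and such words have
orthogonal ranges. -/
lemma gaugeMean_star_frame_mul_frame {i j : List (Fin n) ⊕ ℕ} (h : i ≠ j) :
    gaugeMean (star (frame i₀ i) * frame i₀ j) = 0 := by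
  by_cases hd : frameDegree i = frameDegree j
  · cases i with
    | inl μ =>
      cases j with
      | inl ν =>
        rw [frame, frame, star_word_mul_word_of_ne (by simpa [frameDegree] using hd)
          (fun h' => h (by rw [h'])), gaugeMean_of_mem (zero_mem _)]
      | inr k => simp only [frameDegree] at hd; omega
    | inr k =>
      cases j with
      | inl ν => simp only [frameDegree] at hd; omega
      | inr l => exact absurd (by simp only [frameDegree] at hd; congr 1; omega) h
  · exact gaugeMean_of_isHomogeneous (by omega)
      ((isHomogeneous_frame i₀ i).star.mul (isHomogeneous_frame i₀ j))

/-- In degree `d ≥ 0` the frame element is the prefix of `μ` of length `d`, and the rest of the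
monomial lies in `F`. In degree `-(k + 1)` one coisometry suffices: `S_{i₀}^{k+1}` moves the
monomial into `F`, and its adjoint undoes this exactly. -/
lemma exists_frame_reproduces (μ ν : List (Fin n)) :
    ∃ i, frameDegree i = (μ.length : ℤ) - ν.length ∧
      frame i₀ i * gaugeMean (star (frame i₀ i) * monomial μ ν) = monomial μ ν := by
  rcases le_or_gt ν.length μ.length with h | h
  · obtain ⟨α, β, rfl, hα⟩ : ∃ α β, μ = α ++ β ∧ α.length = μ.length - ν.length :=
      ⟨_, _, (List.take_append_drop (μ.length - ν.length) μ).symm, by simp⟩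
    rw [List.length_append] at hα h
    have h1 : star (word α) * monomial (α ++ β) ν = monomial β ν := by
      rw [monomial_eq, monomial_eq, word_append, ← mul_assoc, ← mul_assoc, star_word_mul_word,
        one_mul]
    refine ⟨.inl α, ?_, ?_⟩
    · simp only [frameDegree, List.length_append]
      omega
    · rw [frame, h1, gaugeMean_of_mem (monomial_mem_core (by omega)), monomial_eq, monomial_eq,
        word_append, mul_assoc]
  · obtain ⟨k, hk⟩ : ∃ k, ν.length = μ.length + (k + 1) := ⟨ν.length - μ.length - 1, by omega⟩
    have h1 : word (List.replicate (k + 1) i₀) * monomial μ ν =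
        monomial (List.replicate (k + 1) i₀ ++ μ) ν := by
      rw [monomial_eq, monomial_eq, word_append, mul_assoc]
    refine ⟨.inr k, ?_, ?_⟩
    · simp only [frameDegree]
      omega
    · rw [frame, star_star, h1, gaugeMean_of_mem (monomial_mem_core (by
        rw [List.length_append, List.length_replicate]; omega)), ← h1, ← mul_assoc,
        star_word_mul_word, one_mul]

variable (τ : core n →ₚ[ℂ] ℂ)

/-- The projection `Θ_{ξ,ξ}` for an element `ξ` of the frame. -/
noncomputable def frameProj (i : List (Fin n) ⊕ ℕ) : L2 τ →L[ℂ] L2 τ :=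
  rankOneEnd τ (frame i₀ i) (frame i₀ i)

lemma frameProj_toL2 (i : List (Fin n) ⊕ ℕ) (a : CuntzAlgebra n) :
    frameProj i₀ τ i (toL2 τ a) = toL2 τ (frame i₀ i * gaugeMean (star (frame i₀ i) * a)) :=
  rankOneEnd_toL2 τ _ _ a

lemma frameProj_mem (i : List (Fin n) ⊕ ℕ) : frameProj i₀ τ i ∈ endVN τ :=
  rankOneEnd_mem_endVN (frame_mem_algSpan i₀ i) (frame_mem_algSpan i₀ i)

lemma frameProj_mul (i j : List (Fin n) ⊕ ℕ) : frameProj i₀ τ i * frameProj i₀ τ j =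
    leftMul τ (frame i₀ i * gaugeMean (star (frame i₀ i) * frame i₀ j)) * coreProj τ *
      leftMul τ (star (frame i₀ j)) := by
  rw [map_mul, mul_assoc (leftMul τ (frame i₀ i)), ← coreProj_mul_leftMul_mul_coreProj, map_mul,
    frameProj, frameProj, rankOneEnd_eq, rankOneEnd_eq]
  simp only [mul_assoc]

lemma isStarProjection_frameProj (i : List (Fin n) ⊕ ℕ) :
    IsStarProjection (frameProj i₀ τ i) where
  isIdempotentElem := by
    rw [IsIdempotentElem, frameProj_mul, gaugeMean_of_mem (star_frame_mul_frame_mem i₀ i),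
      frame_mul_star_mul_frame, mul_assoc]
    rfl
  isSelfAdjoint := star_rankOneEnd τ _ _

lemma frameProj_mul_of_ne {i j : List (Fin n) ⊕ ℕ} (h : i ≠ j) :
    frameProj i₀ τ i * frameProj i₀ τ j = 0 := by
  rw [frameProj_mul, gaugeMean_star_frame_mul_frame i₀ h, mul_zero, map_zero, zero_mul, zero_mul]

lemma exists_frameProj_fixes (μ ν : List (Fin n)) :
    ∃ i, frameDegree i = (μ.length : ℤ) - ν.length ∧
      frameProj i₀ τ i (toL2 τ (monomial μ ν)) = toL2 τ (monomial μ ν) := by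
  obtain ⟨i, hd, hi⟩ := exists_frame_reproduces i₀ μ ν
  exact ⟨i, hd, by rw [frameProj_toL2, hi]⟩

lemma hasSum_frameProj (v : L2 τ) : HasSum (fun i => frameProj i₀ τ i v) v :=
  hasSum_projections (isStarProjection_frameProj i₀ τ)
    (fun _ _ h => frameProj_mul_of_ne i₀ τ h) (dense_span_monomial τ)
    (by rintro _ ⟨μ, ν, rfl⟩
        obtain ⟨i, -, hi⟩ := exists_frameProj_fixes i₀ τ μ ν
        exact ⟨i, hi⟩) v

/-- The coordinate of a vector with respect to an element of the frame. -/
noncomputable def frameCoord (i : List (Fin n) ⊕ ℕ) : L2 τ →L[ℂ] L2 τ :=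
  coreProj τ * leftMul τ (star (frame i₀ i))

lemma star_frameCoord (i : List (Fin n) ⊕ ℕ) :
    star (frameCoord i₀ τ i) = leftMul τ (frame i₀ i) * coreProj τ := by
  rw [frameCoord, star_mul, star_coreProj, ← map_star, star_star]

lemma star_frameCoord_mul (i : List (Fin n) ⊕ ℕ) :
    star (frameCoord i₀ τ i) * frameCoord i₀ τ i = frameProj i₀ τ i := by
  rw [star_frameCoord, frameCoord, mul_assoc, ← mul_assoc (coreProj τ), coreProj_mul_self]
  rfl

lemma star_frameCoord_toL2_one (i : List (Fin n) ⊕ ℕ) :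
    star (frameCoord i₀ τ i) (toL2 τ 1) = toL2 τ (frame i₀ i) := by
  rw [star_frameCoord, mul_apply_eq_comp, coreProj_toL2_of_mem τ (one_mem _), leftMul_toL2_one]

/-- The Parseval identity for the frame. -/
lemma tsum_norm_frameCoord_sq (v : L2 τ) :
    ∑' i, ENNReal.ofReal (‖frameCoord i₀ τ i v‖ ^ 2) = ENNReal.ofReal (‖v‖ ^ 2) := by
  have h1 : ∀ i, ⟪v, frameProj i₀ τ i v⟫_ℂ = ((‖frameCoord i₀ τ i v‖ ^ 2 : ℝ) : ℂ) := fun i => by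
    rw [← star_frameCoord_mul, mul_apply_eq_comp, ContinuousLinearMap.star_eq_adjoint,
      ContinuousLinearMap.adjoint_inner_right, inner_self_eq_norm_sq_to_K]
    norm_cast
  have h2 := (hasSum_frameProj i₀ τ v).mapL (innerSL ℂ v)
  have h4 : ⟪v, v⟫_ℂ = ((‖v‖ ^ 2 : ℝ) : ℂ) := by
    rw [inner_self_eq_norm_sq_to_K]
    norm_cast
  simp only [innerSL_apply_apply, h1, h4] at h2
  have h3 : HasSum (fun i => ‖frameCoord i₀ τ i v‖ ^ 2) (‖v‖ ^ 2) := Complex.hasSum_ofReal.1 h2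
  rw [← h3.tsum_eq, ENNReal.ofReal_tsum_of_nonneg (fun i => by positivity) h3.summable]

end Frame

/-! ### The trace on the endomorphism algebra -/

section Trace

variable {n : ℕ} {τ : core n →ₚ[ℂ] ℂ}

/-- The vector state of `1` is tracial on the operators which commute with right multiplications
and live on the closure of the core. -/
lemma norm_star_apply_one_le (htr : ∀ a b, τ (a * b) = τ (b * a)) {A : L2 τ →L[ℂ] L2 τ}
    (hA : ∀ f ∈ core n, ∀ R : L2 τ →L[ℂ] L2 τ, IsRightMul f R → R * A = A * R)
    (hA' : coreProj τ * star A = star A) : ‖star A (toL2 τ 1)‖ ≤ ‖A (toL2 τ 1)‖ := by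
  have hmem : star A (toL2 τ 1) ∈ coreL2 τ := by
    rw [← hA']
    exact Submodule.starProjection_apply_mem _ _
  -- The adjoint of right multiplication by `f` sends the vector `1` to `f*`.
  have hR : ∀ f ∈ core n, ∀ R : L2 τ →L[ℂ] L2 τ, IsRightMul f R → ∀ w,
      ⟪toL2 τ 1, R w⟫_ℂ = ⟪toL2 τ (star f), w⟫_ℂ := by
    intro f hf R hR w
    refine congrFun ((denseRange_toL2 τ).equalizer (g := fun w => ⟪toL2 τ 1, R w⟫_ℂ)
      (h := fun w => ⟪toL2 τ (star f), w⟫_ℂ) (by fun_prop) (by fun_prop) (funext fun a => ?_)) w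
    change ⟪toL2 τ 1, R (toL2 τ a)⟫_ℂ = ⟪toL2 τ (star f), toL2 τ a⟫_ℂ
    lift f to core n using hf
    rw [hR, inner_toL2, inner_toL2, star_one, one_mul, star_star, gaugeState_apply,
      gaugeState_apply, expectation_mul_right, expectation_mul_left, htr]
  have hnorm : ∀ f ∈ core n, ‖toL2 τ (star f)‖ = ‖toL2 τ f‖ := by
    intro f hf
    lift f to core n using hf
    have h : ∀ g : core n, ((‖toL2 τ (g : CuntzAlgebra n)‖ ^ 2 : ℝ) : ℂ) = τ (star g * g) :=
      fun g => by
        have h1 : expectation n (star (g : CuntzAlgebra n) * g) = star g * g :=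
          expectation_coe (star g * g)
        rw [norm_toL2_sq, gaugeState_apply, h1]
    have h2 := h (star f)
    rw [star_star, htr, ← h f] at h2
    have h3 : ‖toL2 τ ((star f : core n) : CuntzAlgebra n)‖ ^ 2 =
        ‖toL2 τ (f : CuntzAlgebra n)‖ ^ 2 := by exact_mod_cast h2
    exact (sq_eq_sq₀ (norm_nonneg _) (norm_nonneg _)).1 h3
  -- For `v = f` in `F`, `⟨A* 1, f⟩ = ⟨1, A R_f 1⟩ = ⟨1, R_f (A 1)⟩ = ⟨f*, A 1⟩`, and traciality
  -- gives `‖f*‖ = ‖f‖` in `L²`. Density covers the closure, in which `A* 1` itself lies; it is the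
  -- test vector below.
  have hle : ∀ v ∈ coreL2 τ, ‖⟪star A (toL2 τ 1), v⟫_ℂ‖ ≤ ‖A (toL2 τ 1)‖ * ‖v‖ := by
    intro v hv
    refine closure_minimal (t := {v | ‖⟪star A (toL2 τ 1), v⟫_ℂ‖ ≤ ‖A (toL2 τ 1)‖ * ‖v‖})
      ?_ ?_ hv
    · rintro _ ⟨f, hf, rfl⟩
      obtain ⟨R, hRf⟩ := exists_rightMul htr (f := f) hf
      have h1 : toL2 τ f = R (toL2 τ 1) := by rw [hRf, one_mul]
      rw [Set.mem_ofPred_eq, ContinuousLinearMap.star_eq_adjoint,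
        ContinuousLinearMap.adjoint_inner_left, h1, ← mul_apply_eq_comp, ← hA f hf R hRf,
        mul_apply_eq_comp, hR f hf R hRf, ← h1, ← hnorm f hf, mul_comm]
      exact norm_inner_le_norm _ _
    · exact isClosed_le (by fun_prop) (by fun_prop)
  have h := hle _ hmem
  rw [inner_self_eq_norm_sq_to_K, ← RCLike.ofReal_pow, RCLike.norm_ofReal, abs_of_nonneg
    (by positivity), sq] at h
  rcases (norm_nonneg (star A (toL2 τ 1))).eq_or_lt with h0 | h0
  · rw [← h0]
    exact norm_nonneg _
  · exact le_of_mul_le_mul_right h h0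

lemma frameCoord_comm {f : CuntzAlgebra n} {R : L2 τ →L[ℂ] L2 τ} (hR : IsRightMul f R)
    (hf : f ∈ core n) (i₀ : Fin n) (i : List (Fin n) ⊕ ℕ) :
    R * frameCoord i₀ τ i = frameCoord i₀ τ i * R := by
  rw [frameCoord, mul_assoc, hR.leftMul_comm, ← mul_assoc, ← hR.coreProj_comm hf, mul_assoc]

lemma star_frameCoord_comm {f : CuntzAlgebra n} {R : L2 τ →L[ℂ] L2 τ} (hR : IsRightMul f R)
    (hf : f ∈ core n) (i₀ : Fin n) (i : List (Fin n) ⊕ ℕ) :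
    R * star (frameCoord i₀ τ i) = star (frameCoord i₀ τ i) * R := by
  rw [star_frameCoord, mul_assoc, hR.coreProj_comm hf, ← mul_assoc, ← hR.leftMul_comm, mul_assoc]

/-- This is `norm_star_apply_one_le` for the matrix entry `A = c_j T c_i*`, where `c_i` is the
coordinate map and `c_i* 1 = ξ_i`. -/
lemma norm_frameCoord_apply_le (htr : ∀ a b, τ (a * b) = τ (b * a)) (i₀ : Fin n)
    {T : L2 τ →L[ℂ] L2 τ} (hT : T ∈ endVN τ) (i j : List (Fin n) ⊕ ℕ) :
    ‖frameCoord i₀ τ i (star T (toL2 τ (frame i₀ j)))‖ ≤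
      ‖frameCoord i₀ τ j (T (toL2 τ (frame i₀ i)))‖ := by
  have h := norm_star_apply_one_le htr
    (A := frameCoord i₀ τ j * (T * star (frameCoord i₀ τ i))) ?_ ?_
  · rw [star_mul, star_mul, star_star, mul_apply_eq_comp, mul_apply_eq_comp, mul_apply_eq_comp,
      mul_apply_eq_comp, star_frameCoord_toL2_one, star_frameCoord_toL2_one] at h
    exact h
  · intro f hf R hR
    rw [← mul_assoc, frameCoord_comm hR hf, mul_assoc, ← mul_assoc R, hR.comm hf hT, mul_assoc,
      star_frameCoord_comm hR hf]
    simp only [mul_assoc]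
  · rw [star_mul, star_mul, star_star, frameCoord, ← mul_assoc, ← mul_assoc, ← mul_assoc,
      coreProj_mul_self]

/-- The trace `T ↦ ∑ ⟨T ξ, ξ⟩`, the sum being over the frame. -/
noncomputable def frameTrace (i₀ : Fin n) (τ : core n →ₚ[ℂ] ℂ) : (L2 τ →L[ℂ] L2 τ) → ℝ≥0∞ :=
  vectorWeight fun i => toL2 τ (frame i₀ i)

lemma frameTrace_star_mul_self (i₀ : Fin n) (T : L2 τ →L[ℂ] L2 τ) :
    frameTrace i₀ τ (star T * T) =
      ∑' i, ∑' j, ENNReal.ofReal (‖frameCoord i₀ τ j (T (toL2 τ (frame i₀ i)))‖ ^ 2) := by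
  rw [frameTrace, vectorWeight_star_mul_self]
  simp only [tsum_norm_frameCoord_sq]

/-- By Parseval both sides are double sums over matrix entries; exchanging the sums compares entry
`(i, j)` of `T*` with entry `(j, i)` of `T`. The inequality suffices, as it also applies to `T*`. -/
lemma frameTrace_mul_star_le (htr : ∀ a b, τ (a * b) = τ (b * a)) (i₀ : Fin n)
    {T : L2 τ →L[ℂ] L2 τ} (hT : T ∈ endVN τ) :
    frameTrace i₀ τ (T * star T) ≤ frameTrace i₀ τ (star T * T) := by
  have h := frameTrace_star_mul_self i₀ (star T)
  rw [star_star] at h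
  rw [h, frameTrace_star_mul_self, ENNReal.tsum_comm]
  refine ENNReal.tsum_le_tsum fun i => ENNReal.tsum_le_tsum fun j => ?_
  gcongr
  exact norm_frameCoord_apply_le htr i₀ hT i j

lemma frameTrace_tracial (htr : ∀ a b, τ (a * b) = τ (b * a)) (i₀ : Fin n)
    {T : L2 τ →L[ℂ] L2 τ} (hT : T ∈ endVN τ) :
    frameTrace i₀ τ (star T * T) = frameTrace i₀ τ (T * star T) := by
  refine le_antisymm ?_ (frameTrace_mul_star_le htr i₀ hT)
  have h := frameTrace_mul_star_le htr i₀ (star_mem hT)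
  rwa [star_star] at h

/-- Zero trace gives `T ξ = 0` on the frame. Every monomial is some `ξ f` with `f` in `F`, and `T`
commutes with right multiplication by `f`. -/
lemma frameTrace_faithful (htr : ∀ a b, τ (a * b) = τ (b * a)) (i₀ : Fin n)
    {T : L2 τ →L[ℂ] L2 τ} (hT : T ∈ endVN τ) (h0 : 0 ≤ T) (h : frameTrace i₀ τ T = 0) :
    T = 0 := by
  refine ext_monomial fun μ ν => ?_
  obtain ⟨i, -, hi⟩ := exists_frame_reproduces i₀ μ ν
  have hf : gaugeMean (star (frame i₀ i) * monomial μ ν) ∈ core n := gaugeMean_mem _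
  obtain ⟨R, hR⟩ := exists_rightMul htr hf
  have h1 : T (toL2 τ (frame i₀ i)) = 0 :=
    apply_eq_zero_of_vectorWeight_eq_zero (fun i => toL2 τ (frame i₀ i)) h0 h i
  rw [← hi, ← hR, ← mul_apply_eq_comp, ← IsRightMul.comm hR hf hT, mul_apply_eq_comp, h1, map_zero,
    zero_apply]

/-- Traciality rewrites the `i`-th term `τ(Φ(ξ* x) Φ(y* ξ))` as `τ(Φ(y* ξ) Φ(ξ* x)) = ⟨y, Θ_{ξ,ξ}
x⟩`, and the projections `Θ_{ξ,ξ}` sum to `1`. -/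
lemma hasSum_inner_rankOneEnd (htr : ∀ a b, τ (a * b) = τ (b * a)) (i₀ : Fin n)
    (x y : CuntzAlgebra n) :
    HasSum (fun i => ⟪toL2 τ (frame i₀ i), rankOneEnd τ x y (toL2 τ (frame i₀ i))⟫_ℂ)
      (gaugeState τ (star y * x)) := by
  have h := (hasSum_frameProj i₀ τ (toL2 τ x)).mapL (innerSL ℂ (toL2 τ y))
  simp only [innerSL_apply_apply, inner_toL2] at h
  refine (congrArg (HasSum · _) (funext fun i => ?_)).mpr h
  rw [frameProj_toL2, rankOneEnd_toL2, inner_toL2, inner_toL2, ← mul_assoc, ← mul_assoc,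
    gaugeState_apply, gaugeState_apply, expectation_mul_right, htr]
  congr 1
  exact (expectation_mul_right (star y * frame i₀ i) (expectation n (star (frame i₀ i) * x))).symm

lemma rankOneEnd_self_nonneg (x : CuntzAlgebra n) : 0 ≤ rankOneEnd τ x x := by
  have h : rankOneEnd τ x x = star (coreProj τ * leftMul τ (star x)) *
      (coreProj τ * leftMul τ (star x)) := by
    rw [star_mul, star_coreProj, ← map_star, star_star, mul_assoc, ← mul_assoc (coreProj τ),
      coreProj_mul_self]
    rfl
  rw [h]
  exact star_mul_self_nonneg _

lemma frameTrace_rankOneEnd_self_lt_top (htr : ∀ a b, τ (a * b) = τ (b * a)) (i₀ : Fin n)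
    (x : CuntzAlgebra n) : frameTrace i₀ τ (rankOneEnd τ x x) < ∞ :=
  vectorWeight_lt_top_of_summable _ (rankOneEnd_self_nonneg x)
    (hasSum_inner_rankOneEnd htr i₀ x x).summable

/-- Polarization brings `Θ_{x,y}` into the span of the positive operators `Θ_{z,z}`, each of finite
trace. -/
lemma rankOneEnd_polarization (x y : CuntzAlgebra n) :
    (4 : ℂ) • rankOneEnd τ x y = rankOneEnd τ (x + y) (x + y) - rankOneEnd τ (x - y) (x - y) +
      Complex.I • rankOneEnd τ (x + Complex.I • y) (x + Complex.I • y) -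
      Complex.I • rankOneEnd τ (x - Complex.I • y) (x - Complex.I • y) := by
  simp only [rankOneEnd_eq, star_add, star_sub, star_smul, map_add, map_sub, map_smul, mul_add,
    add_mul, mul_sub, sub_mul, smul_mul_assoc, mul_smul_comm, smul_add, smul_sub, smul_smul,
    Complex.star_def, Complex.conj_I]
  simp only [mul_neg, Complex.I_mul_I, neg_neg, one_smul, neg_smul]
  module

lemma rankOneEnd_mem_traceDomain (htr : ∀ a b, τ (a * b) = τ (b * a)) (i₀ : Fin n)
    {x y : CuntzAlgebra n} (hx : x ∈ algSpan n) (hy : y ∈ algSpan n) :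
    rankOneEnd τ x y ∈ (endVN τ).traceDomain (frameTrace i₀ τ) := by
  have h : ∀ z ∈ algSpan n, rankOneEnd τ z z ∈ (endVN τ).traceDomain (frameTrace i₀ τ) :=
    fun z hz => Submodule.subset_span ⟨rankOneEnd_mem_endVN hz hz, rankOneEnd_self_nonneg z,
      frameTrace_rankOneEnd_self_lt_top htr i₀ z⟩
  have hI := Submodule.smul_mem _ Complex.I hy
  have h1 : rankOneEnd τ x y = (4 : ℂ)⁻¹ • (4 : ℂ) • rankOneEnd τ x y := by
    rw [smul_smul, inv_mul_cancel₀ (by norm_num), one_smul]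
  rw [h1, rankOneEnd_polarization]
  exact Submodule.smul_mem _ _ (sub_mem (add_mem (sub_mem (h _ (add_mem hx hy))
    (h _ (sub_mem hx hy))) (Submodule.smul_mem _ _ (h _ (add_mem hx hI))))
    (Submodule.smul_mem _ _ (h _ (sub_mem hx hI))))

lemma exists_frameProj_mul_ne_zero (i₀ : Fin n) {T : L2 τ →L[ℂ] L2 τ} (hT : T ≠ 0) :
    ∃ i, frameProj i₀ τ i * T ≠ 0 := by
  by_contra! h
  refine hT (ContinuousLinearMap.ext fun v => ?_)
  have h1 := hasSum_frameProj i₀ τ (T v)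
  simp only [← mul_apply_eq_comp, h, zero_apply] at h1
  exact h1.unique hasSum_zero

/-- Take `S = T^{1/2} q T^{1/2}` for a frame projection `q` with `q T^{1/2} ≠ 0`. It lies below `T`,
and by traciality its trace is that of `q T q ≤ ‖T‖ q`. -/
lemma frameTrace_semifinite (htr : ∀ a b, τ (a * b) = τ (b * a)) (i₀ : Fin n)
    {T : L2 τ →L[ℂ] L2 τ} (hT : T ∈ endVN τ) (h0 : 0 ≤ T) (hne : T ≠ 0) :
    ∃ S ∈ endVN τ, 0 ≤ S ∧ S ≤ T ∧ S ≠ 0 ∧ frameTrace i₀ τ S < ∞ := by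
  set s := CFC.sqrt T
  have hs : s * s = T := CFC.sqrt_mul_sqrt_self T h0
  have hs' : star s = s := (CFC.sqrt_nonneg T).isSelfAdjoint.star_eq
  have hsmem : s ∈ endVN τ := VonNeumannAlgebra.sqrt_mem hT
  obtain ⟨i, hi⟩ := exists_frameProj_mul_ne_zero i₀ (T := s) fun h => hne (by
    rw [← hs, h, zero_mul])
  set q := frameProj i₀ τ i
  have hq : IsStarProjection q := isStarProjection_frameProj i₀ τ i
  have hqmem : q ∈ endVN τ := frameProj_mem i₀ τ i
  have hmem : q * s ∈ endVN τ := mul_mem hqmem hsmem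
  have h1 : star (q * s) * (q * s) = star s * q * s := by
    rw [star_mul, hq.isSelfAdjoint.star_eq, mul_assoc, ← mul_assoc q, hq.isIdempotentElem.eq,
      mul_assoc]
  refine ⟨star (q * s) * (q * s), mul_mem (star_mem hmem) hmem, star_mul_self_nonneg _, ?_,
    fun h => hi ((CStarRing.star_mul_self_eq_zero_iff _).1 h), ?_⟩
  · rw [h1]
    refine (star_left_conjugate_le_conjugate hq.le_one s).trans_eq ?_
    rw [mul_one, hs', hs]
  · rw [frameTrace_tracial htr i₀ hmem]
    have h2 : q * s * star (q * s) = star q * T * q := by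
      rw [star_mul, hq.isSelfAdjoint.star_eq, hs', ← hs]
      simp only [mul_assoc]
    have h3 : star q * T * q ≤ ((‖T‖₊ : ℝ≥0) : ℂ) • q := by
      refine (CStarAlgebra.star_left_conjugate_le_norm_smul h0.isSelfAdjoint).trans_eq ?_
      rw [hq.isSelfAdjoint.star_eq, hq.isIdempotentElem.eq]
      rfl
    rw [h2]
    refine (vectorWeight_mono _ h3).trans_lt ?_
    rw [vectorWeight_smul]
    exact ENNReal.mul_lt_top ENNReal.coe_lt_top (frameTrace_rankOneEnd_self_lt_top htr i₀ _)

theorem isFNSTrace_frameTrace (htr : ∀ a b, τ (a * b) = τ (b * a)) (i₀ : Fin n) :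
    (endVN τ).IsFNSTrace (frameTrace i₀ τ) where
  map_add _ _ _ _ hS hT := vectorWeight_add _ hS hT
  map_smul c T _ _ := vectorWeight_smul _ c T
  tracial _ hT := frameTrace_tracial htr i₀ hT
  faithful _ hT h0 h := frameTrace_faithful htr i₀ hT h0 h
  normal _ _ hne hdir hpos hT := vectorWeight_eq_iSup _ hne hdir (fun S hS => (hpos S hS).2) hT
  semifinite _ hT h0 hne := frameTrace_semifinite htr i₀ hT h0 hne

/-- Some frame projection `q` has `q z ≠ 0`. As `z` is central, `q z` is a projection below both `z`
and `q`, so it has finite trace and is finite. -/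
theorem isSemifinite_endVN (htr : ∀ a b, τ (a * b) = τ (b * a)) (i₀ : Fin n) :
    (endVN τ).IsSemifinite := by
  intro z hz hz' hproj hne
  obtain ⟨i, hi⟩ := exists_frameProj_mul_ne_zero i₀ hne
  have hq := isStarProjection_frameProj i₀ τ i
  have hqmem := frameProj_mem i₀ τ i
  have hc : frameProj i₀ τ i * z = z * frameProj i₀ τ i :=
    VonNeumannAlgebra.mem_commutant_iff.1 hz' _ hqmem
  have hp : IsStarProjection (frameProj i₀ τ i * z) :=
    ⟨by rw [IsIdempotentElem, mul_assoc, ← mul_assoc z, ← hc, mul_assoc, ← mul_assoc,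
        hq.isIdempotentElem.eq, hproj.isIdempotentElem.eq],
      by rw [IsSelfAdjoint, star_mul, hq.isSelfAdjoint.star_eq, hproj.isSelfAdjoint.star_eq, hc]⟩
  refine ⟨frameProj i₀ τ i * z, (isFNSTrace_frameTrace htr i₀).isFiniteProjection
    (mul_mem hqmem hz) hp ?_, hi, ?_⟩
  · refine (vectorWeight_mono _ (?_ : _ ≤ frameProj i₀ τ i)).trans_lt
      (frameTrace_rankOneEnd_self_lt_top htr i₀ (frame i₀ i))
    rw [hp.le_iff_mul_eq_left hq, hc, mul_assoc, hq.isIdempotentElem.eq]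
  · rw [hp.le_iff_mul_eq_left hproj, mul_assoc, hproj.isIdempotentElem.eq]

end Trace

/-! ### The generator of the gauge action -/

section Generator

variable {n : ℕ} (τ : core n →ₚ[ℂ] ℂ)

/-- The graph of the gauge action generator on `X_c`. -/
noncomputable def generatorGraph : Submodule ℂ (L2 τ × L2 τ) :=
  Submodule.span ℂ {p : L2 τ × L2 τ | ∃ μ ν : List (Fin n),
    p = (toL2 τ (monomial μ ν),
      ((μ.length : ℂ) - (ν.length : ℂ)) • toL2 τ (monomial μ ν))}

lemma gaugeGenerator_eq :
    gaugeGenerator τ = (generatorGraph τ).topologicalClosure.toLinearPMap := rfl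

lemma frameProj_monomial_mem (i₀ : Fin n) (i : List (Fin n) ⊕ ℕ) (μ ν : List (Fin n)) :
    (frameProj i₀ τ i (toL2 τ (monomial μ ν)),
      (frameDegree i : ℂ) • frameProj i₀ τ i (toL2 τ (monomial μ ν))) ∈ generatorGraph τ := by
  obtain ⟨j, hd, hj⟩ := exists_frameProj_fixes i₀ τ μ ν
  by_cases h : i = j
  · subst h
    rw [hj, hd]
    refine Submodule.subset_span ⟨μ, ν, ?_⟩
    push_cast
    rfl
  · rw [← hj, ← mul_apply_eq_comp, frameProj_mul_of_ne i₀ τ h, zero_apply, smul_zero]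
    exact zero_mem _

lemma frameProj_snd_eq_of_mem (i₀ : Fin n) {p : L2 τ × L2 τ} (hp : p ∈ (generatorGraph τ).topologicalClosure)
    (i : List (Fin n) ⊕ ℕ) :
    frameProj i₀ τ i p.2 = (frameDegree i : ℂ) • frameProj i₀ τ i p.1 := by
  have hcl : IsClosed {p : L2 τ × L2 τ | frameProj i₀ τ i p.2 =
      (frameDegree i : ℂ) • frameProj i₀ τ i p.1} :=
    isClosed_eq ((frameProj i₀ τ i).continuous.comp continuous_snd)
      (((frameDegree i : ℂ) • frameProj i₀ τ i).continuous.comp continuous_fst)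
  refine hcl.closure_subset_iff.2 (fun p hp => ?_) hp
  rw [Set.mem_ofPred_eq]
  induction hp using Submodule.span_induction with
  | mem p hp =>
    obtain ⟨μ, ν, rfl⟩ := hp
    obtain ⟨j, hd, hj⟩ := exists_frameProj_fixes i₀ τ μ ν
    by_cases h : i = j
    · subst h
      rw [map_smul, hd]
      push_cast
      rfl
    · have h0 : frameProj i₀ τ i (toL2 τ (monomial μ ν)) = 0 := by
        rw [← hj, ← mul_apply_eq_comp, frameProj_mul_of_ne i₀ τ h, zero_apply]
      rw [map_smul, h0, smul_zero, smul_zero]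
  | zero => simp
  | add p p' _ _ h h' => rw [Prod.snd_add, Prod.fst_add, map_add, map_add, h, h', smul_add]
  | smul c p _ h => rw [Prod.smul_snd, Prod.smul_fst, map_smul, map_smul, h, smul_comm]

lemma frameProj_mem_closure (i₀ : Fin n) (i : List (Fin n) ⊕ ℕ) (v : L2 τ) :
    (frameProj i₀ τ i v, (frameDegree i : ℂ) • frameProj i₀ τ i v) ∈
      (generatorGraph τ).topologicalClosure := by
  have hcl : IsClosed {v : L2 τ | (frameProj i₀ τ i v,
      (frameDegree i : ℂ) • frameProj i₀ τ i v) ∈ (generatorGraph τ).topologicalClosure} :=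
    (Submodule.isClosed_topologicalClosure (generatorGraph τ)).preimage
      ((frameProj i₀ τ i).continuous.prodMk ((frameDegree i : ℂ) • frameProj i₀ τ i).continuous)
  refine hcl.closure_subset_iff.2 (fun v hv => ?_) (dense_span_monomial τ v)
  rw [Set.mem_ofPred_eq]
  induction hv using Submodule.span_induction with
  | mem v hv =>
    obtain ⟨μ, ν, rfl⟩ := hv
    exact Submodule.le_topologicalClosure _ (frameProj_monomial_mem τ i₀ i μ ν)
  | zero =>
    rw [map_zero, smul_zero]
    exact zero_mem (generatorGraph τ).topologicalClosure
  | add v w _ _ h h' =>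
    rw [map_add, smul_add]
    exact add_mem h h'
  | smul c v _ h =>
    rw [map_smul, smul_comm]
    exact Submodule.smul_mem _ c h

/-- The generator of the gauge action is diagonal with respect to the frame. -/
lemma mem_closure_generatorGraph_iff (i₀ : Fin n) {p : L2 τ × L2 τ} :
    p ∈ (generatorGraph τ).topologicalClosure ↔
      ∀ i, frameProj i₀ τ i p.2 = (frameDegree i : ℂ) • frameProj i₀ τ i p.1 := by
  refine ⟨frameProj_snd_eq_of_mem τ i₀, fun h => ?_⟩
  -- Conversely, `p` is the limit of its partial frame expansions, which lie in the closed graph by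
  -- the eigenvalue relations.
  have h1 := (hasSum_frameProj i₀ τ p.1).prodMk (hasSum_frameProj i₀ τ p.2)
  simp only [h] at h1
  exact (Submodule.isClosed_topologicalClosure _).mem_of_tendsto h1
    (Filter.Eventually.of_forall fun s => sum_mem fun i _ => frameProj_mem_closure τ i₀ i p.1)

/-- Closability: if `(0, w)` lies in the closure, every frame projection kills `w`, so `w = 0`.
Hence the closure is again the graph of an operator. -/
lemma graph_gaugeGenerator (i₀ : Fin n) :
    (gaugeGenerator τ).graph = (generatorGraph τ).topologicalClosure := by
  rw [gaugeGenerator_eq]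
  refine Submodule.toLinearPMap_graph_eq _ fun p hp h0 => ?_
  rw [mem_closure_generatorGraph_iff τ i₀] at hp
  simp only [h0, map_zero, smul_zero] at hp
  have h1 := hasSum_frameProj i₀ τ p.2
  simp only [hp] at h1
  exact h1.unique hasSum_zero

/-- The graph is cut out by relations involving only projections of `N`, with which elements of the
commutant commute. -/
theorem isAffiliated_gaugeGenerator (i₀ : Fin n) : (endVN τ).IsAffiliated (gaugeGenerator τ) where
  isClosed := by
    rw [LinearPMap.IsClosed, graph_gaugeGenerator τ i₀]
    exact Submodule.isClosed_topologicalClosure _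
  dense_domain := by
    refine (dense_span_monomial τ).mono ?_
    rw [SetLike.coe_subset_coe, Submodule.span_le]
    rintro _ ⟨μ, ν, rfl⟩
    have h : (toL2 τ (monomial μ ν), ((μ.length : ℂ) - (ν.length : ℂ)) • toL2 τ (monomial μ ν)) ∈
        (gaugeGenerator τ).graph := by
      rw [graph_gaugeGenerator τ i₀]
      exact Submodule.le_topologicalClosure _ (Submodule.subset_span ⟨μ, ν, rfl⟩)
    exact LinearPMap.mem_domain_of_mem_graph h
  commute u hu _ v := by
    have hv := (gaugeGenerator τ).mem_graph v
    rw [graph_gaugeGenerator τ i₀, mem_closure_generatorGraph_iff τ i₀] at hv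
    have huv : (u (v : L2 τ), u (gaugeGenerator τ v)) ∈ (gaugeGenerator τ).graph := by
      rw [graph_gaugeGenerator τ i₀, mem_closure_generatorGraph_iff τ i₀]
      intro i
      have hc := VonNeumannAlgebra.mem_commutant_iff.1 hu _ (frameProj_mem i₀ τ i)
      rw [← mul_apply_eq_comp, ← mul_apply_eq_comp, hc, mul_apply_eq_comp, mul_apply_eq_comp, hv,
        map_smul]
    exact ⟨LinearPMap.mem_domain_of_mem_graph huv, ((gaugeGenerator τ).image_iff _).2 huv |>.symm⟩

end Generator

end CuntzAlgebra

theorem proposition8p4 (n : ℕ) (hn : 2 ≤ n) :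
    -- `τ` is the unique faithful normalised trace on the fixed point algebra `F`
    ∃ τ : core n →ₚ[ℂ] ℂ, IsFaithfulNormalizedTrace τ ∧
      (∀ τ' : core n →ₚ[ℂ] ℂ, IsFaithfulNormalizedTrace τ' → τ' = τ) ∧
      (endVN τ).IsSemifinite ∧
      (∃ τt : (L2 τ →L[ℂ] L2 τ) → ℝ≥0∞, (endVN τ).IsFNSTrace τt ∧
        -- `t` is the linear extension of the trace `τt` to its domain of definition
        ∃ t : (endVN τ).traceDomain τt →ₗ[ℂ] ℂ,
          (∀ (T : L2 τ →L[ℂ] L2 τ) (hT : T ∈ endVN τ ∧ 0 ≤ T ∧ τt T < ∞),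
            t ⟨T, Submodule.subset_span hT⟩ = ((τt T).toReal : ℂ)) ∧
          ∀ x ∈ algSpan n, ∀ y ∈ algSpan n,
            ∃ h : rankOneEnd τ x y ∈ (endVN τ).traceDomain τt,
              t ⟨rankOneEnd τ x y, h⟩ = gaugeState τ (star y * x)) ∧
      (endVN τ).IsAffiliated (gaugeGenerator τ) := by
  have hn0 : 0 < n := by omega
  -- Any letter serves to build the negative part of the frame.
  let i₀ : Fin n := ⟨0, hn0⟩
  obtain ⟨τ, hτ⟩ := exists_isFaithfulNormalizedTrace hn0
  have htr := hτ.map_mul_comm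
  obtain ⟨t, ht⟩ := (endVN τ).exists_linear_extension fun i => toL2 τ (frame i₀ i)
  refine ⟨τ, hτ, fun τ' hτ' => hτ.unique hn0.ne' hτ', isSemifinite_endVN htr i₀,
    ⟨frameTrace i₀ τ, isFNSTrace_frameTrace htr i₀, t, fun T hT => ?_, fun x hx y hy => ?_⟩,
    isAffiliated_gaugeGenerator τ i₀⟩
  · exact (ht ⟨T, Submodule.subset_span hT⟩).unique
      (hasSum_inner_of_vectorWeight_lt_top _ hT.2.1 hT.2.2)
  · have h := rankOneEnd_mem_traceDomain htr i₀ hx hy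
    exact ⟨h, (ht ⟨_, h⟩).unique (hasSum_inner_rankOneEnd htr i₀ x y)⟩
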